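/- Fix $q\in\mathbb{C}$ with $0<|q|<1$ and a branch of $\log q$, so that $q^{\lambda}=e^{\lambda\log q}$ (take the principal one). Write $$(a)_\infty=\prod_{n\ge 0}(1-aq^n),\quad (a_1,\dots,a_r)_\infty=\prod_j (a_j)_\infty,\quad \theta(z)=(z,q/z)_\infty,\quad \theta(z_1,\dots,z_r)=\prod_j\theta(z_j),$$ $$\int_0^{\tau}f(s)\,d_qs=(1-q)\sum_{n\ge 0}f(\tau q^n)\,\tau q^n,\qquad \int_{\tau_1}^{\tau_2}f\,d_qs=\int_0^{\tau_2}f\,d_qs-\int_0^{\tau_1}f\,d_qs .$$ Let $h_i,l_i,\nu,\alpha\in\mathbb{C}$ and $t_i,x\in\mathbb{C}\setminus\{0\}$ $(i=1,2,3)$ satisfy $$q^{2\nu}=q^{h_1+h_2+h_3-l_1-l_2-l_3+1}.$$ Put $\tau_i=q^{-h_i-1/2}/t_i$ $(i=1,2,3)$, $\tau_4=q^{1-\nu}/x$, and $$\varphi^{\mathcal H_3}_{i,j}=x^{\nu-\alpha}\int_{\tau_i}^{\tau_j}\frac{(q^{\nu}xs,\;q^{h_1+1/2}t_1s,\;q^{h_2+1/2}t_2s,\;q^{h_3+1/2}t_3s)_\infty}{(xs,\;q^{\nu+l_1-1/2}t_1s,\;q^{\nu+l_2-1/2}t_2s,\;q^{\nu+l_3-1/2}t_3s)_\infty}\,d_qs$$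 (principal branch of $x^{\nu-\alpha}$), and $$C_1=\frac{\theta\left(q^{h_1-l_1-\nu+1},\ \frac{t_1}{t_2}q^{h_1-l_2-\nu+1},\ \frac{t_1}{t_3}q^{h_1-l_3-\nu+1},\ \frac{x}{t_1}q^{3/2-h_1},\ \frac{x}{t_2}q^{-h_2+\nu-1/2},\ \frac{x}{t_3}q^{-h_3+\nu-1/2}\right)}{\theta\left(q^{\nu-1},\ \frac{t_1}{t_2}q^{h_1-h_2},\ \frac{t_1}{t_3}q^{h_1-h_3},\ \frac{x}{t_1}q^{1/2-l_1},\ \frac{x}{t_2}q^{1/2-l_2},\ \frac{x}{t_3}q^{1/2-l_3}\right)},$$ $$C_2=C_1\big|_{h_1\leftrightarrow h_2,\ l_1\leftrightarrow l_2,\ t_1\leftrightarrow t_2},\qquad C_3=C_1\big|_{h_1\leftrightarrow h_3,\ l_1\leftrightarrow l_3,\ t_1\leftrightarrow t_3}.$$ Assume that the denominators of $C_1,C_2,C_3$ are non-zero and that the denominator of the integrand does not vanish at any point $s=\tau_iq^n$ $(i=1,\dots,4,\ n\ge 0)$. Then the series defining the integrals $\int_0^{\tau_i}$ $(i=1,\dots,4)$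 of this integrand converge absolutely, and $$C_1\,\varphi^{\mathcal H_3}_{1,4}+C_2\,\varphi^{\mathcal H_3}_{2,4}+C_3\,\varphi^{\mathcal H_3}_{3,4}=0 .$$ -/

import Mathlib

namespace QH3

noncomputable section

/-- The infinite `q`-shifted factorial `(a)_∞ = ∏_{n ≥ 0} (1 - a q^n)`. -/
def qPoch (q a : ℂ) : ℂ := ∏' n : ℕ, (1 - a * q ^ n)

/-- For `|q| < 1` the product defining `(a)_∞` converges. -/
theorem multipliable_qPoch {q : ℂ} (hq : ‖q‖ < 1) (a : ℂ) :
    Multipliable fun n : ℕ => 1 - a * q ^ n := by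
  have h : Summable fun n : ℕ => ‖-(a * q ^ n)‖ := by
    simpa [norm_mul, norm_pow] using
      (summable_geometric_of_lt_one (norm_nonneg q) hq).mul_left ‖a‖
  simpa [sub_eq_add_neg] using multipliable_one_add_of_summable h

/-- The theta function `θ(z) = (z)_∞ (q/z)_∞`. -/
def theta (q z : ℂ) : ℂ := qPoch q z * qPoch q (q / z)

/-- The Jackson integral `∫_0^τ f(s) d_q s`. -/
def jacksonZero (q : ℂ) (f : ℂ → ℂ) (τ : ℂ) : ℂ :=
  (1 - q) * ∑' n : ℕ, f (τ * q ^ n) * (τ * q ^ n)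

/-- The Jackson integral `∫_{τ₁}^{τ₂} f(s) d_q s`. -/
def jackson (q : ℂ) (f : ℂ → ℂ) (τ₁ τ₂ : ℂ) : ℂ :=
  jacksonZero q f τ₂ - jacksonZero q f τ₁

/-- Numerator of the integrand:
`(q^ν x s)_∞ ∏_{i=1}^3 (q^{h_i+1/2} t_i s)_∞`. -/
def integrandNum (q ν : ℂ) (h t : Fin 3 → ℂ) (x s : ℂ) : ℂ :=
  qPoch q (q ^ ν * x * s) * ∏ i : Fin 3, qPoch q (q ^ (h i + 1 / 2) * t i * s)

/-- Denominator of the integrand: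
`(x s)_∞ ∏_{i=1}^3 (q^{ν+l_i-1/2} t_i s)_∞`. -/
def integrandDen (q ν : ℂ) (l t : Fin 3 → ℂ) (x s : ℂ) : ℂ :=
  qPoch q (x * s) * ∏ i : Fin 3, qPoch q (q ^ (ν + l i - 1 / 2) * t i * s)

/-- The integrand of Riemann-Papperitz type. -/
def integrand (q ν : ℂ) (h l t : Fin 3 → ℂ) (x s : ℂ) : ℂ :=
  integrandNum q ν h t x s / integrandDen q ν l t x s

/-- The end points `τ_i = q^{-h_i-1/2} / t_i` (`i = 1, 2, 3`) and `τ_4 = q^{1-ν} / x`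
(indices shifted by one: `0, 1, 2, 3`). -/
def node (q ν : ℂ) (h t : Fin 3 → ℂ) (x : ℂ) : Fin 4 → ℂ :=
  ![q ^ (-h 0 - 1 / 2) / t 0, q ^ (-h 1 - 1 / 2) / t 1, q ^ (-h 2 - 1 / 2) / t 2,
    q ^ (1 - ν) / x]

/-- The integrals `φ_{i,j} = x^{ν-α} ∫_{τ_i}^{τ_j} (integrand) d_q s`
(indices shifted by one). -/
def phi (q ν α : ℂ) (h l t : Fin 3 → ℂ) (i j : Fin 4) (x : ℂ) : ℂ :=
  x ^ (ν - α) *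
    jackson q (integrand q ν h l t x) (node q ν h t x i) (node q ν h t x j)

/-- Numerator of the coefficient `C_1`. -/
def coeffNum (q ν : ℂ) (h l t : Fin 3 → ℂ) (x : ℂ) : ℂ :=
  theta q (q ^ (h 0 - l 0 - ν + 1)) *
  theta q (t 0 * q ^ (h 0 - l 1 - ν + 1) / t 1) *
  theta q (t 0 * q ^ (h 0 - l 2 - ν + 1) / t 2) *
  theta q (x * q ^ (3 / 2 - h 0) / t 0) *
  theta q (x * q ^ (-h 1 + ν - 1 / 2) / t 1) *
  theta q (x * q ^ (-h 2 + ν - 1 / 2) / t 2)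

/-- Denominator of the coefficient `C_1`. -/
def coeffDen (q ν : ℂ) (h l t : Fin 3 → ℂ) (x : ℂ) : ℂ :=
  theta q (q ^ (ν - 1)) *
  theta q (t 0 * q ^ (h 0 - h 1) / t 1) *
  theta q (t 0 * q ^ (h 0 - h 2) / t 2) *
  theta q (x * q ^ (1 / 2 - l 0) / t 0) *
  theta q (x * q ^ (1 / 2 - l 1) / t 1) *
  theta q (x * q ^ (1 / 2 - l 2) / t 2)

/-- The family `v` with its first and its `k`-th entry exchanged. -/
def exch (k : Fin 3) (v : Fin 3 → ℂ) : Fin 3 → ℂ := fun i => v (Equiv.swap 0 k i)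

/-- The coefficient `C_k` (index shifted by one): `C_1` with the parameters of index `1` and `k`
exchanged. -/
def coeff (q ν : ℂ) (h l t : Fin 3 → ℂ) (x : ℂ) (k : Fin 3) : ℂ :=
  coeffNum q ν (exch k h) (exch k l) (exch k t) x /
    coeffDen q ν (exch k h) (exch k l) (exch k t) x

end

end QH3

namespace QH3

open Filter Topology Finset Polynomial

/-! Let a_i, b_i (i = 0, ..., 3) be the numerator and denominator parameters of the integrand
(`numPar`, `denPar`), let J_i be the Jackson integral from 0 to q/a_i, and put w_i = a_i² ∏_j
θ(a_i/b_j) / ∏_{j≠i} θ(a_i/a_j). The condition on ν says ∏ a_j = q² ∏ b_j. If no ratio a_i/a_j (i ≠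
j) is a power of q, then ∑ w_i J_i = 0 (`sum_theta_mul_jacksonZero_eq_zero`) and ∑ w_i = 0
(`sum_sq_mul_theta_eq_zero`). Eliminating the term i = 3 leaves ∑_{i<3} w_i (J_3 - J_i) = 0, and
each w_i is the corresponding coefficient C times a factor common to all three (`coeffVal_eq`).

Both relations are limits of a finite residue theorem for truncations of ∏_j (w/b_j)_∞ / (w/a_j)_∞,
a function with poles at a_i q^{-n}. Letting the number of poles in each row grow with n fixed gives
one-sided sums, which are the Jackson integrals. For the second relation, auxiliary poles c q^{-M}
and c q^{1-M} in the middle of rows of length 2M make the limit bilateral; each row then contributes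
a telescoping sum independent of i times a theta quotient, whence `sum_prod_theta_eq_zero`.
Quasi-periodicity of θ supplies the a_i².

The hypotheses allow a_3/a_i to be a power of q for some i < 3; in that case every term of the
relation vanishes separately. -/

/-! ### q-shifted factorials: splitting, zeros, bounds. -/

/-- The finite `q`-shifted factorial `(a)_n = ∏_{k < n} (1 - a q^k)`. -/
noncomputable def qPochFin (q a : ℂ) (n : ℕ) : ℂ := ∏ k ∈ range n, (1 - a * q ^ k)

theorem qPochFin_add (q a : ℂ) (m n : ℕ) :
    qPochFin q a (m + n) = qPochFin q a m * qPochFin q (a * q ^ m) n := by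
  simp only [qPochFin, prod_range_add, pow_add, mul_assoc]

theorem tendsto_qPochFin {q : ℂ} (hq : ‖q‖ < 1) (a : ℂ) :
    Tendsto (qPochFin q a) atTop (𝓝 (qPoch q a)) :=
  (multipliable_qPoch hq a).tendsto_prod_tprod_nat

theorem qPoch_eq_mul {q : ℂ} (hq : ‖q‖ < 1) (a : ℂ) (n : ℕ) :
    qPoch q a = qPochFin q a n * qPoch q (a * q ^ n) := by
  have h1 := (tendsto_qPochFin hq a).comp (tendsto_add_atTop_nat n)
  have h2 := (tendsto_qPochFin hq (a * q ^ n)).const_mul (qPochFin q a n)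
  refine tendsto_nhds_unique h1 (h2.congr fun k => ?_)
  simp [← qPochFin_add, add_comm]

theorem qPoch_eq_one_sub_mul {q : ℂ} (hq : ‖q‖ < 1) (a : ℂ) :
    qPoch q a = (1 - a) * qPoch q (a * q) := by
  simpa [qPochFin] using qPoch_eq_mul hq a 1

theorem qPochFin_eq_zero_iff {q a : ℂ} {n : ℕ} :
    qPochFin q a n = 0 ↔ ∃ k < n, a * q ^ k = 1 := by
  simp only [qPochFin, prod_eq_zero_iff, sub_eq_zero, mem_range, eq_comm (a := (1 : ℂ))]

theorem summable_norm_mul_pow {q : ℂ} (hq : ‖q‖ < 1) (a : ℂ) :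
    Summable fun n : ℕ => ‖-(a * q ^ n)‖ := by
  simpa [norm_mul, norm_pow] using
    (summable_geometric_of_lt_one (norm_nonneg q) hq).mul_left ‖a‖

theorem qPoch_eq_zero_iff {q : ℂ} (hq : ‖q‖ < 1) {a : ℂ} :
    qPoch q a = 0 ↔ ∃ k : ℕ, a * q ^ k = 1 := by
  constructor
  · intro h
    by_contra! hne
    refine tprod_one_add_ne_zero_of_summable (f := fun k => -(a * q ^ k)) (fun k hk => hne k ?_)
      (summable_norm_mul_pow hq a) ?_
    · linear_combination -hk
    · simpa [qPoch, sub_eq_add_neg] using h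
  · rintro ⟨k, hk⟩
    rw [qPoch_eq_mul hq a (k + 1), qPochFin_eq_zero_iff.2 ⟨k, by simp, hk⟩, zero_mul]

theorem exists_norm_le_of_tendsto {u : ℕ → ℂ} {l : ℂ} (hu : Tendsto u atTop (𝓝 l)) :
    ∃ C, ∀ n, ‖u n‖ ≤ C := by
  obtain ⟨C, hC⟩ := hu.norm.bddAbove_range
  exact ⟨C, fun n => hC ⟨n, rfl⟩⟩

theorem norm_qPochFin_le {q : ℂ} (hq : ‖q‖ < 1) (a : ℂ) (n : ℕ) :
    ‖qPochFin q a n‖ ≤ Real.exp (‖a‖ * (1 - ‖q‖)⁻¹) := by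
  have hs := (summable_geometric_of_lt_one (norm_nonneg q) hq).mul_left ‖a‖
  calc ‖qPochFin q a n‖ = ∏ k ∈ range n, ‖1 - a * q ^ k‖ := by simp [qPochFin, norm_prod]
    _ ≤ ∏ k ∈ range n, (1 + ‖a‖ * ‖q‖ ^ k) := by
        refine prod_le_prod (fun _ _ => norm_nonneg _) fun k _ => ?_
        simpa using norm_sub_le (1 : ℂ) (a * q ^ k)
    _ ≤ Real.exp (∑ k ∈ range n, ‖a‖ * ‖q‖ ^ k) :=
        Real.prod_one_add_le_exp_sum _ fun k => by positivity
    _ ≤ _ := by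
        refine Real.exp_le_exp.2 ?_
        refine (hs.sum_le_tsum _ fun k _ => by positivity).trans_eq ?_
        rw [tsum_mul_left, tsum_geometric_of_lt_one (norm_nonneg q) hq]

theorem norm_qPoch_le {q : ℂ} (hq : ‖q‖ < 1) (a : ℂ) :
    ‖qPoch q a‖ ≤ Real.exp (‖a‖ * (1 - ‖q‖)⁻¹) :=
  le_of_tendsto (tendsto_qPochFin hq a).norm (Eventually.of_forall (norm_qPochFin_le hq a))

theorem exists_norm_qPoch_mul_pow_le {q : ℂ} (hq : ‖q‖ < 1) (a : ℂ) :
    ∃ C, ∀ n : ℕ, ‖qPoch q (a * q ^ n)‖ ≤ C := by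
  refine ⟨Real.exp (‖a‖ * (1 - ‖q‖)⁻¹), fun n => (norm_qPoch_le hq _).trans ?_⟩
  have : ‖a * q ^ n‖ ≤ ‖a‖ := by
    rw [norm_mul, norm_pow]
    exact mul_le_of_le_one_right (norm_nonneg _) (pow_le_one₀ (norm_nonneg _) hq.le)
  have h0 : 0 ≤ (1 - ‖q‖)⁻¹ := inv_nonneg.2 (by linarith)
  gcongr

/-- The inverse equals (a)_n / (a)_∞, a convergent sequence in n. -/
theorem exists_norm_inv_qPoch_mul_pow_le {q : ℂ} (hq : ‖q‖ < 1) {a : ℂ} (ha : qPoch q a ≠ 0) :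
    ∃ C, ∀ n : ℕ, ‖(qPoch q (a * q ^ n))⁻¹‖ ≤ C := by
  obtain ⟨C, hC⟩ := exists_norm_le_of_tendsto (((tendsto_qPochFin hq a)).div_const (qPoch q a))
  refine ⟨C, fun n => ?_⟩
  convert hC n using 2
  have h := qPoch_eq_mul hq a n
  have h1 : qPoch q (a * q ^ n) ≠ 0 := fun h0 => ha (by rw [h, h0, mul_zero])
  rw [inv_eq_one_div, div_eq_div_iff h1 ha, one_mul, h]

/-! ### Theta functions: quasi-periodicity, reflection, zeros. -/

/-- `θ(q z) = -θ(z) / z`. -/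
theorem theta_q_mul {q : ℂ} (hq : ‖q‖ < 1) (hq0 : q ≠ 0) {z : ℂ} (hz : z ≠ 0) :
    theta q (q * z) = -theta q z / z := by
  have h1 := qPoch_eq_one_sub_mul hq z
  have h2 := qPoch_eq_one_sub_mul hq (1 / z)
  have e1 : q / (q * z) = 1 / z := by field_simp
  have e2 : 1 / z * q = q / z := by field_simp
  rw [e2] at h2
  rw [theta, theta, e1, h1, h2, mul_comm z q]
  field_simp
  ring

theorem theta_q_div (q : ℂ) (hq0 : q ≠ 0) (z : ℂ) : theta q (q / z) = theta q z := by
  rcases eq_or_ne z 0 with rfl | hz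
  · simp [theta]
  · rw [theta, theta, mul_comm]
    congr 2
    field_simp

theorem theta_eq_zero_iff {q : ℂ} (hq : ‖q‖ < 1) (hq0 : q ≠ 0) {z : ℂ} (hz : z ≠ 0) :
    theta q z = 0 ↔ ∃ m : ℤ, z = q ^ m := by
  rw [theta, mul_eq_zero, qPoch_eq_zero_iff hq, qPoch_eq_zero_iff hq]
  constructor
  · rintro (⟨k, hk⟩ | ⟨k, hk⟩)
    · exact ⟨-k, by rw [zpow_neg, zpow_natCast]; exact eq_inv_of_mul_eq_one_left hk⟩
    · refine ⟨k + 1, ?_⟩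
      rw [zpow_add_one₀ hq0, zpow_natCast]
      field_simp at hk
      linear_combination -hk
  · rintro ⟨m, rfl⟩
    rcases le_or_gt m 0 with hm | hm
    · left
      obtain ⟨k, rfl⟩ := Int.exists_eq_neg_ofNat hm
      exact ⟨k, by simp [hq0]⟩
    · right
      obtain ⟨k, rfl⟩ := Int.eq_succ_of_zero_lt hm
      refine ⟨k, ?_⟩
      rw [zpow_add_one₀ hq0, zpow_natCast]
      field_simp

/-! ### Finite residue sums of rational functions. -/

/-- The sum is, up to sign, the sum of the residues of P(w) / ∏ (1 - w/v_r), which has none at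
infinity under the degree bound. Algebraically, it is a multiple of the coefficient of degree #s - 1
in the Lagrange form of P. -/
theorem sum_mul_eval_div_prod_eq_zero {σ : Type*} [DecidableEq σ] {s : Finset σ} {v : σ → ℂ}
    (hv : Set.InjOn v s) (h0 : ∀ p ∈ s, v p ≠ 0) {P : ℂ[X]} (hP : P.natDegree + 2 ≤ #s) :
    ∑ p ∈ s, v p * P.eval (v p) / ∏ r ∈ s.erase p, (1 - v p / v r) = 0 := by
  have hdeg : P.degree < #s :=
    degree_le_natDegree.trans_lt (by exact_mod_cast (by omega : P.natDegree < #s))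
  have h1 := Lagrange.coeff_eq_sum hv hdeg
  rw [coeff_eq_zero_of_natDegree_lt (by omega)] at h1
  have h2 : ∀ p ∈ s, v p * P.eval (v p) / ∏ r ∈ s.erase p, (1 - v p / v r) =
      (-∏ r ∈ s, -v r) * (P.eval (v p) / ∏ r ∈ s.erase p, (v p - v r)) := by
    intro p hp
    have h3 : ∏ r ∈ s.erase p, (v p - v r) =
        (∏ r ∈ s.erase p, -v r) * ∏ r ∈ s.erase p, (1 - v p / v r) := by
      rw [← prod_mul_distrib]
      refine prod_congr rfl fun r hr => ?_
      have := h0 r (mem_of_mem_erase hr)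
      field_simp
      ring
    have h4 : ∏ r ∈ s.erase p, -v r ≠ 0 :=
      prod_ne_zero_iff.2 fun r hr => neg_ne_zero.2 (h0 r (mem_of_mem_erase hr))
    rw [h3, ← mul_prod_erase s _ hp]
    generalize ∏ r ∈ s.erase p, -v r = A at *
    rw [div_eq_mul_inv, div_eq_mul_inv, mul_inv]
    field_simp
  rw [sum_congr rfl h2, ← mul_sum, ← h1, mul_zero]

theorem image_erase_of_injOn {σ : Type*} [DecidableEq σ] {s : Finset σ} {v : σ → ℂ}
    (hv : Set.InjOn v s) {p : σ} (hp : p ∈ s) :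
    (s.image v).erase (v p) = (s.erase p).image v := by
  ext z
  simp only [mem_erase, mem_image]
  constructor
  · rintro ⟨hz, r, hr, rfl⟩
    exact ⟨r, ⟨fun h => hz (by rw [h]), hr⟩, rfl⟩
  · rintro ⟨r, ⟨hrp, hr⟩, rfl⟩
    exact ⟨fun h => hrp (hv hr hp h), r, hr, rfl⟩

/-- This is the residue sum with two further poles c and d, which is why P may now have degree #s.
-/
theorem sum_mul_eval_div_prod_eq_sub {σ : Type*} [DecidableEq σ] {s : Finset σ} {v : σ → ℂ}
    (hv : Set.InjOn v s) (h0 : ∀ p ∈ s, v p ≠ 0) {P : ℂ[X]} (hP : P.natDegree ≤ #s)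
    {c d : ℂ} (hc0 : c ≠ 0) (hd0 : d ≠ 0) (hcd : c ≠ d) (hc : ∀ p ∈ s, v p ≠ c)
    (hd : ∀ p ∈ s, v p ≠ d) :
    ∑ p ∈ s, v p / ((v p - c) * (v p - d)) *
        (P.eval (v p) / ∏ r ∈ s.erase p, (1 - v p / v r)) =
      (P.eval c / ∏ r ∈ s, (1 - c / v r) - P.eval d / ∏ r ∈ s, (1 - d / v r)) / (c - d) := by
  classical
  -- Indexing the nodes by their own values lets c and d be adjoined without enlarging the index
  -- type.
  set S : Finset ℂ := s.image v with hS
  have hdS : d ∉ S := by simpa [hS] using hd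
  have hcS : c ∉ S := by simpa [hS] using hc
  have hcS' : c ∉ insert d S := by simp [hcd, hcS]
  have hcard : #(insert c (insert d S)) = #s + 2 := by
    rw [card_insert_of_notMem hcS', card_insert_of_notMem hdS, card_image_of_injOn hv]
  have key := sum_mul_eval_div_prod_eq_zero (s := insert c (insert d S)) (v := id) (P := P)
    Function.injective_id.injOn (by
      intro p hp
      simp only [hS, mem_insert, mem_image] at hp
      rcases hp with rfl | rfl | ⟨r, hr, rfl⟩
      exacts [hc0, hd0, h0 r hr]) (by omega)
  simp only [id] at key
  rw [sum_insert hcS', sum_insert hdS, erase_insert hcS', prod_insert hdS,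
    erase_insert_of_ne hcd, erase_insert hdS, prod_insert hcS, hS, sum_image hv,
    prod_image hv, prod_image hv] at key
  have h2 : ∀ p ∈ s, v p * P.eval (v p) /
      ∏ r ∈ (insert c (insert d (image v s))).erase (v p), (1 - v p / r) =
      c * d * (v p / ((v p - c) * (v p - d)) *
        (P.eval (v p) / ∏ r ∈ s.erase p, (1 - v p / v r))) := by
    intro p hp
    have hpc := hc p hp
    have hpd := hd p hp
    rw [erase_insert_of_ne hpc.symm, erase_insert_of_ne hpd.symm, image_erase_of_injOn hv hp,
      prod_insert, prod_insert, prod_image]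
    · have e1 : 1 - v p / c = (v p - c) / (-c) := by field_simp; ring
      have e2 : 1 - v p / d = (v p - d) / (-d) := by field_simp; ring
      rw [e1, e2]
      have := sub_ne_zero.2 hpc
      have := sub_ne_zero.2 hpd
      generalize ∏ r ∈ s.erase p, (1 - v p / v r) = A
      rw [div_eq_mul_inv, div_eq_mul_inv _ A, mul_inv]
      field_simp
    · exact hv.mono (by simp)
    · simp only [mem_image, not_exists, not_and]
      exact fun r hr => hd r (mem_of_mem_erase hr)
    · simp only [mem_insert, hcd, mem_image, not_or, not_exists, not_and]
      exact ⟨not_false, fun r hr => hc r (mem_of_mem_erase hr)⟩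
  rw [sum_congr rfl h2, ← mul_sum] at key
  have e1 : 1 - c / d = (d - c) / d := by field_simp
  have e2 : 1 - d / c = (c - d) / c := by field_simp
  rw [e1, e2] at key
  have hcd' := sub_ne_zero.2 hcd
  have hdc' := sub_ne_zero.2 hcd.symm
  generalize ∑ p ∈ s, v p / ((v p - c) * (v p - d)) *
        (P.eval (v p) / ∏ r ∈ s.erase p, (1 - v p / v r)) = A at *
  generalize ∏ r ∈ s, (1 - c / v r) = B at *
  generalize ∏ r ∈ s, (1 - d / v r) = B' at *
  have k2 : c * d * (A - (P.eval c / B - P.eval d / B') / (c - d)) = 0 := by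
    rw [← key]
    have e3 : c * P.eval c / ((d - c) / d * B) = c * d * (P.eval c / B) * (-1 / (c - d)) := by
      rw [div_eq_mul_inv, mul_inv, div_eq_mul_inv _ B, ← neg_sub c d]
      field_simp
    have e4 : d * P.eval d / ((c - d) / c * B') = c * d * (P.eval d / B') * (1 / (c - d)) := by
      rw [div_eq_mul_inv, mul_inv, div_eq_mul_inv _ B']
      field_simp
    rw [e3, e4]
    ring
  rcases mul_eq_zero.1 k2 with h | h
  · exact absurd h (mul_ne_zero hc0 hd0)
  · exact sub_eq_zero.1 h

/-! ### Products over geometric progressions. -/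

/-- The monomial factor `∏_{r=1}^{n} (-q^{-r})` of shifted products. -/
noncomputable def shiftFactor (q : ℂ) (n : ℕ) : ℂ := ∏ r ∈ range n, -(q ^ (r + 1))⁻¹

theorem shiftFactor_ne_zero {q : ℂ} (hq0 : q ≠ 0) (n : ℕ) : shiftFactor q n ≠ 0 :=
  prod_ne_zero_iff.2 fun _ _ => neg_ne_zero.2 (inv_ne_zero (pow_ne_zero _ hq0))

/-- Reversing the order of the factors, 1 - z q^{-r} = -z q^{-r} (1 - q^r/z) for r = 1, ..., n. -/
theorem prod_one_sub_div_pow {q z : ℂ} (hq0 : q ≠ 0) (hz : z ≠ 0) (n : ℕ) :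
    ∏ k ∈ range n, (1 - z * q ^ k / q ^ n) = qPochFin q (q / z) n * (z ^ n * shiftFactor q n) := by
  have hzn : z ^ n = ∏ k ∈ range n, z := by simp
  rw [← prod_range_reflect, qPochFin, shiftFactor, hzn, ← prod_mul_distrib, ← prod_mul_distrib]
  refine prod_congr rfl fun k hk => ?_
  have hk' : n = n - 1 - k + (k + 1) := by have := mem_range.1 hk; omega
  have : q ^ n = q ^ (n - 1 - k) * q ^ (k + 1) := by rw [← pow_add, ← hk']
  rw [this, pow_succ]
  field_simp
  ring

/-- The indices k ≥ n give (z)_{N-n}; those below n are reflected. -/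
theorem prod_one_sub_shift {q z : ℂ} (hq0 : q ≠ 0) (hz : z ≠ 0) {n N : ℕ} (hn : n ≤ N) :
    ∏ k ∈ range N, (1 - z * q ^ k / q ^ n) =
      qPochFin q z (N - n) * qPochFin q (q / z) n * (z ^ n * shiftFactor q n) := by
  obtain ⟨u, rfl⟩ := Nat.exists_eq_add_of_le hn
  rw [prod_range_add, prod_one_sub_div_pow hq0 hz, Nat.add_sub_cancel_left, qPochFin]
  have : ∀ k ∈ range u, 1 - z * q ^ (n + k) / q ^ n = 1 - z * q ^ k := by
    intro k _
    rw [pow_add]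
    field_simp
  rw [prod_congr rfl this, qPochFin]
  ring

/-- This is the case z = 1 with its zero factor removed, so the upper part starts at q and is one
factor shorter. -/
theorem prod_erase_one_sub_shift {q : ℂ} (hq0 : q ≠ 0) {n N : ℕ} (hn : n < N) :
    ∏ k ∈ (range N).erase n, (1 - q ^ k / q ^ n) =
      qPochFin q q (N - 1 - n) * qPochFin q q n * shiftFactor q n := by
  obtain ⟨u, rfl⟩ := Nat.exists_eq_add_of_lt hn
  have h1 : ∏ k ∈ (range (n + u + 1)).erase n, (1 - q ^ k / q ^ n) =
      ∏ k ∈ range (n + u + 1), if k = n then 1 else (1 - q ^ k / q ^ n) := by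
    rw [← prod_erase (range (n + u + 1)) (a := n) (by simp)]
    exact prod_congr rfl fun k hk => by rw [if_neg (ne_of_mem_erase hk)]
  rw [h1, add_assoc, prod_range_add, prod_range_succ']
  have h2 : ∀ k ∈ range n, (if k = n then 1 else (1 - q ^ k / q ^ n)) =
      1 - 1 * q ^ k / q ^ n := fun k hk => by
    rw [if_neg (mem_range.1 hk).ne, one_mul]
  have h3 : ∀ k ∈ range u, (if n + (k + 1) = n then 1 else (1 - q ^ (n + (k + 1)) / q ^ n)) =
      1 - q * q ^ k := fun k _ => by
    rw [if_neg (by omega), pow_add, pow_succ]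
    field_simp
  have h4 : n + (u + 1) - 1 - n = u := by omega
  rw [prod_congr rfl h2, prod_congr rfl h3, prod_one_sub_div_pow hq0 one_ne_zero, h4]
  simp only [add_zero, if_true, one_pow, div_one, qPochFin]
  ring

/-! ### Limits of sums by dominated convergence. -/

theorem tendsto_sum_range_mul_sub {g B : ℕ → ℂ} {β : ℂ} (hg : Summable fun n => ‖g n‖)
    (hB : Tendsto B atTop (𝓝 β)) :
    Tendsto (fun M : ℕ => ∑ n ∈ range (M + 1), g n * B (M - n)) atTop
      (𝓝 ((∑' n, g n) * β)) := by
  obtain ⟨C, hC⟩ := exists_norm_le_of_tendsto hB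
  rw [← tsum_mul_right]
  have h : ∀ M : ℕ, ∑ n ∈ range (M + 1), g n * B (M - n) =
      ∑' n, if n < M + 1 then g n * B (M - n) else 0 := by
    intro M
    rw [tsum_eq_sum (s := range (M + 1)) fun n hn => if_neg (by simpa using hn)]
    exact sum_congr rfl fun n hn => (if_pos (mem_range.1 hn)).symm
  simp only [h]
  refine tendsto_tsum_of_dominated_convergence (hg.mul_right C) (fun n => ?_)
    (Eventually.of_forall fun M n => ?_)
  · have h1 : Tendsto (fun M : ℕ => g n * B (M - n)) atTop (𝓝 (g n * β)) :=
      (hB.comp (tendsto_sub_atTop_nat n)).const_mul _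
    refine h1.congr' ?_
    filter_upwards [eventually_ge_atTop n] with M hM
    rw [if_pos (by omega)]
  · split_ifs
    · rw [norm_mul]
      exact mul_le_mul_of_nonneg_left (hC _) (norm_nonneg _)
    · simpa using mul_nonneg (norm_nonneg (g n)) ((norm_nonneg _).trans (hC 0))

theorem sum_range_two_mul {φ : ℕ → ℂ} (M : ℕ) :
    ∑ n ∈ range (2 * M), φ n = ∑ m ∈ Ico (-(M : ℤ)) M, φ (m + M).toNat := by
  refine sum_bij' (fun n _ => (n : ℤ) - M) (fun m _ => (m + M).toNat) ?_ ?_ ?_ ?_ ?_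
  · intro n hn
    simp only [mem_range, mem_Ico] at *
    omega
  · intro m hm
    simp only [mem_range, mem_Ico] at *
    omega
  · intro n _
    simp
  · intro m hm
    simp only [mem_Ico] at hm
    omega
  · intro n _
    simp

/-- Writing n = M + m, both n and 2M - n tend to infinity for fixed m, while the boundedness of A
and B gives the dominating series. -/
theorem tendsto_sum_range_bilateral {W : ℤ → ℂ} {A B : ℕ → ℂ} {α β : ℂ}
    (hW : Summable fun n => ‖W n‖) (hA : Tendsto A atTop (𝓝 α)) (hB : Tendsto B atTop (𝓝 β)) :
    Tendsto (fun M : ℕ => ∑ n ∈ range (2 * M), W ((n : ℤ) - M) * (A n * B (2 * M - n))) atTop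
      (𝓝 ((∑' m, W m) * (α * β))) := by
  obtain ⟨C, hC⟩ := exists_norm_le_of_tendsto hA
  obtain ⟨D, hD⟩ := exists_norm_le_of_tendsto hB
  have hC0 : 0 ≤ C := (norm_nonneg _).trans (hC 0)
  have hD0 : 0 ≤ D := (norm_nonneg _).trans (hD 0)
  rw [← tsum_mul_right]
  have h : ∀ M : ℕ, ∑ n ∈ range (2 * M), W ((n : ℤ) - M) * (A n * B (2 * M - n)) =
      ∑' m : ℤ, if -(M : ℤ) ≤ m ∧ m < M then
        W m * (A (m + M).toNat * B (M - m).toNat) else 0 := by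
    intro M
    rw [tsum_eq_sum (s := Ico (-(M : ℤ)) M) fun n hn => if_neg (by simpa using hn),
      sum_range_two_mul]
    refine sum_congr rfl fun m hm => ?_
    have hm' := mem_Ico.1 hm
    rw [if_pos hm']
    have e1 : (((m + M).toNat : ℕ) : ℤ) - M = m := by omega
    have e2 : 2 * M - (m + M).toNat = (M - m).toNat := by omega
    rw [e1, e2]
  simp only [h]
  refine tendsto_tsum_of_dominated_convergence (hW.mul_right (C * D)) (fun m => ?_)
    (Eventually.of_forall fun M m => ?_)
  · have t1 : Tendsto (fun M : ℕ => (m + M).toNat) atTop atTop :=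
      tendsto_atTop.2 fun b => by
        filter_upwards [eventually_ge_atTop (b + m.natAbs)] with M hM
        omega
    have t2 : Tendsto (fun M : ℕ => ((M : ℤ) - m).toNat) atTop atTop :=
      tendsto_atTop.2 fun b => by
        filter_upwards [eventually_ge_atTop (b + m.natAbs)] with M hM
        omega
    refine (((hA.comp t1).mul (hB.comp t2)).const_mul (W m)).congr' ?_
    filter_upwards [eventually_ge_atTop (m.natAbs + 1)] with M hM
    rw [if_pos (by omega)]
    rfl
  · split_ifs
    · rw [norm_mul, norm_mul]
      gcongr
      · exact hC _
      · exact hD _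
    · simpa using mul_nonneg (norm_nonneg (W m)) (mul_nonneg hC0 hD0)

/-! ### The grid of poles a_i q^{-n} and the values of the truncated products there. -/

/-- The polynomial `∏_j ∏_{k < N} (1 - w q^k / b_j)` in `w`. -/
noncomputable def gridPoly {ι : Type*} [Fintype ι] (q : ℂ) (b : ι → ℂ) (N : ℕ) : ℂ[X] :=
  ∏ j, ∏ k ∈ range N, (1 - C (q ^ k / b j) * X)

theorem eval_gridPoly {ι : Type*} [Fintype ι] (q : ℂ) (b : ι → ℂ) (N : ℕ) (w : ℂ) :
    (gridPoly q b N).eval w = ∏ j, ∏ k ∈ range N, (1 - w * q ^ k / b j) := by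
  simp only [gridPoly, eval_prod, eval_sub, eval_one, eval_mul, eval_C, eval_X]
  refine prod_congr rfl fun j _ => prod_congr rfl fun k _ => ?_
  ring

theorem natDegree_gridPoly_le {ι : Type*} [Fintype ι] (q : ℂ) (b : ι → ℂ) (N : ℕ) :
    (gridPoly q b N).natDegree ≤ Fintype.card ι * N := by
  refine (natDegree_prod_le _ _).trans ((sum_le_card_nsmul _ _ N fun j _ => ?_).trans_eq (by simp))
  refine (natDegree_prod_le _ _).trans ((sum_le_card_nsmul _ _ 1 fun k _ => ?_).trans_eq (by simp))
  compute_degree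

/-- The nodes `a_i q^{-n}`. -/
noncomputable def gridNode {ι : Type*} (q : ℂ) (a : ι → ℂ) (p : ι × ℕ) : ℂ := a p.1 / q ^ p.2

/-- The index set of the nodes `a_i q^{-n}` with `n < N`. -/
def grid (ι : Type*) [Fintype ι] (N : ℕ) : Finset (ι × ℕ) := univ ×ˢ range N

theorem card_grid (ι : Type*) [Fintype ι] (N : ℕ) : #(grid ι N) = Fintype.card ι * N := by simp [grid, card_product]

theorem pow_injective_of_norm_lt_one {q : ℂ} (hq : ‖q‖ < 1) (hq0 : q ≠ 0) :
    Function.Injective fun m : ℤ => q ^ m := by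
  intro m n h
  have h' : ‖q‖ ^ m = ‖q‖ ^ n := by rw [← norm_zpow, ← norm_zpow]; exact congrArg _ h
  exact zpow_right_injective₀ (norm_pos_iff.2 hq0) hq.ne h'

theorem gridNode_injective {ι : Type*} {q : ℂ} (hq : ‖q‖ < 1) (hq0 : q ≠ 0) {a : ι → ℂ} (ha : ∀ i, a i ≠ 0)
    (hgen : ∀ i j, i ≠ j → ∀ m : ℤ, a i / a j ≠ q ^ m) : Function.Injective (gridNode q a) := by
  rintro ⟨i, n⟩ ⟨j, k⟩ h
  simp only [gridNode] at h
  have hk := pow_ne_zero k hq0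
  have hn := pow_ne_zero n hq0
  have haj := ha j
  have h1 : a i / a j = q ^ ((n : ℤ) - k) := by
    rw [zpow_sub₀ hq0, zpow_natCast, zpow_natCast]
    rw [div_eq_div_iff hn hk] at h
    rw [div_eq_div_iff haj hk]
    linear_combination h
  by_cases hij : i = j
  · subst hij
    rw [div_self haj] at h1
    have := pow_injective_of_norm_lt_one hq hq0 (a₁ := 0) (a₂ := (n : ℤ) - k) (by simpa using h1)
    simp only [Prod.mk.injEq, true_and]
    omega
  · exact absurd h1 (hgen i j hij _)

theorem eval_gridPoly_gridNode {ι : Type*} [Fintype ι] {q : ℂ} (hq0 : q ≠ 0) {b : ι → ℂ} (hb : ∀ i, b i ≠ 0)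
    {c : ℂ} (hc : c ≠ 0) {n N : ℕ} (hn : n ≤ N) :
    (gridPoly q b N).eval (c / q ^ n) =
      (∏ j, qPochFin q (c / b j) (N - n)) * (∏ j, qPochFin q (q / (c / b j)) n) *
        ∏ j, ((c / b j) ^ n * shiftFactor q n) := by
  rw [eval_gridPoly, ← prod_mul_distrib, ← prod_mul_distrib]
  refine prod_congr rfl fun j _ => ?_
  rw [← prod_one_sub_shift hq0 (div_ne_zero hc (hb j)) hn]
  refine prod_congr rfl fun k _ => ?_
  ring

theorem prod_grid {ι : Type*} [Fintype ι] {q : ℂ} (hq0 : q ≠ 0) {a : ι → ℂ} (ha : ∀ i, a i ≠ 0)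
    {c : ℂ} (hc : c ≠ 0) {n N : ℕ} (hn : n ≤ N) :
    ∏ r ∈ grid ι N, (1 - c / q ^ n / gridNode q a r) =
      (∏ j, qPochFin q (c / a j) (N - n)) * (∏ j, qPochFin q (q / (c / a j)) n) *
        ∏ j, ((c / a j) ^ n * shiftFactor q n) := by
  rw [← eval_gridPoly_gridNode hq0 ha hc hn, eval_gridPoly, grid, prod_product]
  refine prod_congr rfl fun j _ => prod_congr rfl fun k _ => ?_
  rw [gridNode, div_div_eq_mul_div]

/-- Only row i loses a node; the other rows are full shifted products. -/
theorem prod_grid_erase {ι : Type*} [Fintype ι] [DecidableEq ι] {q : ℂ} (hq0 : q ≠ 0) {a : ι → ℂ} (ha : ∀ i, a i ≠ 0)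
    (i : ι) {n N : ℕ} (hn : n < N) :
    ∏ r ∈ (grid ι N).erase (i, n), (1 - gridNode q a (i, n) / gridNode q a r) =
      ((∏ j ∈ univ.erase i, qPochFin q (a i / a j) (N - n)) * qPochFin q q (N - 1 - n)) *
        (∏ j, qPochFin q (q / (a i / a j)) n) * ∏ j, ((a i / a j) ^ n * shiftFactor q n) := by
  have h1 : (grid ι N).erase (i, n) =
      (univ.erase i) ×ˢ range N ∪ {i} ×ˢ (range N).erase n := by
    ext ⟨j, k⟩
    simp only [grid, mem_erase, mem_product, mem_univ, mem_range, mem_union, mem_singleton,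
      Prod.mk.injEq, ne_eq]
    tauto
  have h2 : Disjoint ((univ.erase i) ×ˢ range N) ({i} ×ˢ (range N).erase n) :=
    disjoint_product.2 (Or.inl (by simp))
  rw [h1, prod_union h2, prod_product, prod_product, prod_singleton]
  have h3 : ∀ k ∈ (range N).erase n, 1 - gridNode q a (i, n) / gridNode q a (i, k) =
      1 - q ^ k / q ^ n := fun k _ => by
    have := ha i
    simp only [gridNode]
    field_simp
  have h4 : ∀ j ∈ univ.erase i, ∏ k ∈ range N, (1 - gridNode q a (i, n) / gridNode q a (j, k)) =
      qPochFin q (a i / a j) (N - n) * qPochFin q (q / (a i / a j)) n *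
        ((a i / a j) ^ n * shiftFactor q n) := fun j _ => by
    rw [← prod_one_sub_shift hq0 (div_ne_zero (ha i) (ha j)) hn.le]
    refine prod_congr rfl fun k _ => ?_
    have := ha j
    simp only [gridNode]
    field_simp
  rw [prod_congr rfl h3, prod_congr rfl h4, prod_erase_one_sub_shift hq0 hn,
    ← mul_prod_erase univ (fun j => qPochFin q (q / (a i / a j)) n) (mem_univ i),
    ← mul_prod_erase univ (fun j => (a i / a j) ^ n * shiftFactor q n) (mem_univ i),
    prod_mul_distrib, prod_mul_distrib, div_self (ha i), div_one, one_pow, one_mul]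
  ring

/-- Numerator and denominator have equally many parameters, so c and the powers of q cancel. This is
where the balancing condition acts on the residue sums. -/
theorem prod_monomial_div {ι : Type*} [Fintype ι] {q : ℂ} (hq0 : q ≠ 0) {a b : ι → ℂ} {c : ℂ}
    (hc : c ≠ 0) (n : ℕ) :
    (∏ j, ((c / b j) ^ n * shiftFactor q n)) / ∏ j, ((c / a j) ^ n * shiftFactor q n) =
      ((∏ j, a j) / ∏ j, b j) ^ n := by
  rw [← prod_div_distrib, ← prod_div_distrib, ← prod_pow]
  refine prod_congr rfl fun j _ => ?_
  rw [mul_div_mul_right _ _ (shiftFactor_ne_zero hq0 n), ← div_pow]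
  congr 1
  field_simp

theorem qPoch_ne_zero_of_forall_ne {q z : ℂ} (hq : ‖q‖ < 1) (hq0 : q ≠ 0) (hz : z ≠ 0)
    (h : ∀ m : ℤ, z ≠ q ^ m) : qPoch q z ≠ 0 ∧ qPoch q (q / z) ≠ 0 := by
  have : theta q z ≠ 0 := fun h0 => by
    obtain ⟨m, hm⟩ := (theta_eq_zero_iff hq hq0 hz).1 h0
    exact h m hm
  exact mul_ne_zero_iff.1 this

theorem qPoch_self_ne_zero {q : ℂ} (hq : ‖q‖ < 1) : qPoch q q ≠ 0 := by
  rw [ne_eq, qPoch_eq_zero_iff hq]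
  rintro ⟨k, hk⟩
  have h1 : ‖q‖ ^ (k + 1) = 1 := by
    rw [← norm_pow, pow_succ, mul_comm, hk, norm_one]
  have := pow_lt_one₀ (norm_nonneg q) hq (Nat.succ_ne_zero k)
  exact this.ne h1

theorem summable_norm_pow_mul {q : ℂ} (hq : ‖q‖ < 1) {u : ℕ → ℂ} {C : ℝ}
    (hu : ∀ n, ‖u n‖ ≤ C) : Summable fun n => ‖q ^ n * u n‖ := by
  refine ((summable_geometric_of_lt_one (norm_nonneg q) hq).mul_right C).of_nonneg_of_le
    (fun n => norm_nonneg _) fun n => ?_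
  rw [norm_mul, norm_pow]
  exact mul_le_mul_of_nonneg_left (hu n) (by positivity)

/-- Only countably many values of c are excluded. -/
theorem exists_forall_ne_zpow {ι : Type*} [Countable ι] (q : ℂ) (a : ι → ℂ) :
    ∃ c : ℂ, c ≠ 0 ∧ ∀ i, ∀ m : ℤ, a i / q ^ m ≠ c := by
  have hS : (insert 0 (Set.range fun p : ι × ℤ => a p.1 / q ^ p.2)).Countable :=
    (Set.countable_range _).insert 0
  obtain ⟨c, hc⟩ := (Set.ne_univ_iff_exists_notMem _).1 fun h =>
    not_countable_complex (h ▸ hS)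
  simp only [Set.mem_insert_iff, Set.mem_range, Prod.exists, not_or, not_exists] at hc
  exact ⟨c, hc.1, hc.2⟩

/-! ### The two limiting residue identities. -/

section Residues

variable {ι : Type*} [Fintype ι] [DecidableEq ι] {q : ℂ} {a b : ι → ℂ}

theorem mul_mul_div_mul_mul (x y m x' y' m' : ℂ) :
    x * y * m / (x' * y' * m') = m / m' * ((y / y') * (x / x')) := by
  simp only [div_eq_mul_inv, mul_inv]
  ring

theorem tendsto_head (hq : ‖q‖ < 1) (hq0 : q ≠ 0) (ha : ∀ i, a i ≠ 0)
    (hgen : ∀ i j, i ≠ j → ∀ m : ℤ, a i / a j ≠ q ^ m) (i : ι) :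
    Tendsto (fun n => (∏ j, qPochFin q (q / (a i / b j)) n) /
        ∏ j, qPochFin q (q / (a i / a j)) n) atTop
      (𝓝 ((∏ j, qPoch q (q / (a i / b j))) / ∏ j, qPoch q (q / (a i / a j)))) := by
  refine (tendsto_finsetProd _ fun j _ => tendsto_qPochFin hq _).div
    (tendsto_finsetProd _ fun j _ => tendsto_qPochFin hq _) (prod_ne_zero_iff.2 fun j _ => ?_)
  by_cases hij : i = j
  · subst hij
    rw [div_self (ha i), div_one]
    exact qPoch_self_ne_zero hq
  · exact (qPoch_ne_zero_of_forall_ne hq hq0 (div_ne_zero (ha i) (ha j)) (hgen i j hij)).2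

theorem prod_erase_qPoch_ne_zero (hq : ‖q‖ < 1) (hq0 : q ≠ 0) (ha : ∀ i, a i ≠ 0)
    (hgen : ∀ i j, i ≠ j → ∀ m : ℤ, a i / a j ≠ q ^ m) (i : ι) :
    ∏ j ∈ univ.erase i, qPoch q (a i / a j) ≠ 0 :=
  prod_ne_zero_iff.2 fun j hj =>
    (qPoch_ne_zero_of_forall_ne hq hq0 (div_ne_zero (ha i) (ha j))
      (hgen i j (ne_of_mem_erase hj).symm)).1

/-- This is the limit M → ∞ of the residue sum with M numerator factors per b_j and M + 1 poles per
a_j. The surplus of one pole per row meets the degree bound because there are at least two rows. -/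
theorem sum_unilateral_eq_zero (hq : ‖q‖ < 1) (hq0 : q ≠ 0) (hι : 2 ≤ Fintype.card ι)
    (ha : ∀ i, a i ≠ 0) (hb : ∀ i, b i ≠ 0)
    (hgen : ∀ i j, i ≠ j → ∀ m : ℤ, a i / a j ≠ q ^ m)
    (hbal : ∏ j, a j = q ^ 2 * ∏ j, b j) :
    ∑ i, a i * ((∑' n : ℕ, q ^ n * ((∏ j, qPochFin q (q / (a i / b j)) n) /
        ∏ j, qPochFin q (q / (a i / a j)) n)) *
      ((∏ j, qPoch q (a i / b j)) /
        ((∏ j ∈ univ.erase i, qPoch q (a i / a j)) * qPoch q q))) = 0 := by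
  have hlim : ∀ i : ι, Tendsto (fun M : ℕ => a i * ∑ n ∈ range (M + 1),
      (q ^ n * ((∏ j, qPochFin q (q / (a i / b j)) n) / ∏ j, qPochFin q (q / (a i / a j)) n)) *
      ((∏ j, qPochFin q (a i / b j) (M - n)) /
        ((∏ j ∈ univ.erase i, qPochFin q (a i / a j) (M - n + 1)) * qPochFin q q (M - n)))) atTop
      (𝓝 (a i * ((∑' n : ℕ, q ^ n * ((∏ j, qPochFin q (q / (a i / b j)) n) /
        ∏ j, qPochFin q (q / (a i / a j)) n)) *
      ((∏ j, qPoch q (a i / b j)) /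
        ((∏ j ∈ univ.erase i, qPoch q (a i / a j)) * qPoch q q))))) := by
    intro i
    obtain ⟨C, hC⟩ := exists_norm_le_of_tendsto (tendsto_head (b := b) hq hq0 ha hgen i)
    refine (tendsto_sum_range_mul_sub (B := fun u => (∏ j, qPochFin q (a i / b j) u) /
        ((∏ j ∈ univ.erase i, qPochFin q (a i / a j) (u + 1)) * qPochFin q q u))
      (summable_norm_pow_mul hq hC) ?_).const_mul (a i)
    refine (tendsto_finsetProd _ fun j _ => tendsto_qPochFin hq _).div
      ((tendsto_finsetProd _ fun j _ => ?_).mul (tendsto_qPochFin hq _))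
      (mul_ne_zero (prod_erase_qPoch_ne_zero hq hq0 ha hgen i) (qPoch_self_ne_zero hq))
    exact (tendsto_qPochFin hq _).comp (tendsto_add_atTop_nat 1)
  refine tendsto_nhds_unique (tendsto_finsetSum _ fun i _ => hlim i)
    (tendsto_const_nhds.congr fun M => ?_)
  have hb0 : ∏ j, b j ≠ 0 := prod_ne_zero_iff.2 fun j _ => hb j
  have key := sum_mul_eval_div_prod_eq_zero (s := grid ι (M + 1)) (v := gridNode q a)
    (P := gridPoly q b M) (gridNode_injective hq hq0 ha hgen).injOn
    (fun p _ => div_ne_zero (ha _) (pow_ne_zero _ hq0)) (by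
      have := natDegree_gridPoly_le q b M
      rw [card_grid, mul_add, mul_one]
      omega)
  rw [grid, sum_product] at key
  rw [← key]
  refine sum_congr rfl fun i _ => ?_
  rw [mul_sum]
  refine sum_congr rfl fun n hn => ?_
  have hn' := mem_range.1 hn
  rw [← grid, prod_grid_erase hq0 ha i hn', gridNode, eval_gridPoly_gridNode hq0 hb (ha i)
    (by omega)]
  have hm := prod_monomial_div (a := a) (b := b) hq0 (ha i) n
  rw [hbal, mul_div_cancel_right₀ _ hb0] at hm
  have e1 : M + 1 - n = M - n + 1 := by omega
  have e2 : M + 1 - 1 - n = M - n := by omega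
  rw [e1, e2]
  -- The factor q^{2n} from the balancing turns the residue weight a_i q^{-n} into the Jackson
  -- weight q^n.
  have e3 : a i / q ^ n * (q ^ 2) ^ n = a i * q ^ n := by
    have := pow_ne_zero n hq0
    field_simp
    ring
  rw [mul_div_assoc, mul_mul_div_mul_mul, hm, ← mul_assoc (a i / q ^ n), e3]
  ring

/-- A telescoping bilateral sum. -/
theorem hasSum_bilateral_weight (hq : ‖q‖ < 1) (hq0 : q ≠ 0) {x c : ℂ} (hx : x ≠ 0) (hc : c ≠ 0)
    (hxc : ∀ m : ℤ, x / q ^ m ≠ c) :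
    (Summable fun m : ℤ => ‖x / q ^ m / ((x / q ^ m - c) * (x / q ^ m - c * q))‖) ∧
    ∑' m : ℤ, x / q ^ m / ((x / q ^ m - c) * (x / q ^ m - c * q)) = -(1 / (c * (1 - q))) := by
  set W : ℤ → ℂ := fun m => x / q ^ m / ((x / q ^ m - c) * (x / q ^ m - c * q)) with hWdef
  have hq1 : 1 - q ≠ 0 := sub_ne_zero.2 fun h => by rw [← h, norm_one] at hq; exact lt_irrefl _ hq
  have hqz : ∀ m : ℤ, q ^ m ≠ 0 := fun m => zpow_ne_zero m hq0
  have hpow : Tendsto (fun n : ℕ => q ^ n) atTop (𝓝 0) := tendsto_pow_atTop_nhds_zero_of_norm_lt_one hq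
  have hne1 : ∀ m : ℤ, x / q ^ m - c ≠ 0 := fun m => sub_ne_zero.2 (hxc m)
  have hne2 : ∀ m : ℤ, x / q ^ m - c * q ≠ 0 := fun m h => by
    apply hne1 (m + 1)
    have := hqz m
    rw [zpow_add_one₀ hq0]
    field_simp at h ⊢
    linear_combination h
  -- the two halves are dominated by a geometric series
  have hpos : ∀ n : ℕ, W n = q ^ n * (x / ((x - c * q ^ n) * (x - c * q * q ^ n))) := by
    intro n
    have h1 := hne1 n
    have h2 := hne2 n
    have h0 := pow_ne_zero n hq0
    simp only [hWdef, zpow_natCast] at h1 h2 ⊢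
    have e1 : x / q ^ n - c = (x - c * q ^ n) / q ^ n := by field_simp
    have e2 : x / q ^ n - c * q = (x - c * q * q ^ n) / q ^ n := by field_simp
    rw [e1] at h1 ⊢
    rw [e2] at h2 ⊢
    have h1' := (div_ne_zero_iff.1 h1).1
    have h2' := (div_ne_zero_iff.1 h2).1
    field_simp
  have hneg : ∀ n : ℕ, W (-(n : ℤ)) = q ^ n * (x / ((x * q ^ n - c) * (x * q ^ n - c * q))) := by
    intro n
    simp only [hWdef, zpow_neg, zpow_natCast, div_inv_eq_mul]
    ring
  have s1 : Summable fun n : ℕ => ‖W n‖ := by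
    have t : Tendsto (fun n : ℕ => x / ((x - c * q ^ n) * (x - c * q * q ^ n))) atTop
        (𝓝 (x / ((x - c * 0) * (x - c * q * 0)))) :=
      tendsto_const_nhds.div ((tendsto_const_nhds.sub (hpow.const_mul _)).mul
        (tendsto_const_nhds.sub (hpow.const_mul _))) (by simp [hx])
    obtain ⟨C, hC⟩ := exists_norm_le_of_tendsto t
    simpa only [hpos] using summable_norm_pow_mul hq hC
  have s2 : Summable fun n : ℕ => ‖W (-(n : ℤ))‖ := by
    have t : Tendsto (fun n : ℕ => x / ((x * q ^ n - c) * (x * q ^ n - c * q))) atTop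
        (𝓝 (x / ((x * 0 - c) * (x * 0 - c * q)))) :=
      tendsto_const_nhds.div (((hpow.const_mul _).sub tendsto_const_nhds).mul
        ((hpow.const_mul _).sub tendsto_const_nhds)) (by simp [hc, hq0])
    obtain ⟨C, hC⟩ := exists_norm_le_of_tendsto t
    simpa only [hneg] using summable_norm_pow_mul hq hC
  have hs : Summable fun m : ℤ => ‖W m‖ := Summable.of_nat_of_neg s1 s2
  refine ⟨hs, ?_⟩
  -- Partial fractions in y = x/q^m: the pole y = c q is the pole y = c of the next term.
  have htel : ∀ m : ℤ, W m =
      1 / (c * (1 - q)) * (c / (x / q ^ m - c) - c / (x / q ^ (m + 1) - c)) := by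
    intro m
    have h1 := hne1 m
    have h2 := hne2 m
    have h3 := hqz m
    have e : x / q ^ (m + 1) - c = (x / q ^ m - c * q) / q := by
      rw [zpow_add_one₀ hq0]
      field_simp
    rw [e]
    simp only [hWdef]
    generalize x / q ^ m = y at *
    field_simp
    ring
  have hG1 : Tendsto (fun n : ℕ => c / (x / q ^ (n : ℤ) - c)) atTop (𝓝 0) := by
    have t : Tendsto (fun n : ℕ => c * q ^ n / (x - c * q ^ n)) atTop
        (𝓝 (c * 0 / (x - c * 0))) :=
      (hpow.const_mul _).div (tendsto_const_nhds.sub (hpow.const_mul _)) (by simpa using hx)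
    rw [mul_zero, zero_div] at t
    refine t.congr fun n => ?_
    have h0 := pow_ne_zero n hq0
    have e1 : x / q ^ n - c = (x - c * q ^ n) / q ^ n := by field_simp
    rw [zpow_natCast, e1, div_div_eq_mul_div]
  -- The limits 0 at +∞ and -1 at -∞ determine the total; x drops out.
  have hG2 : Tendsto (fun n : ℕ => c / (x / q ^ (-(n : ℤ)) - c)) atTop (𝓝 (-1)) := by
    have t : Tendsto (fun n : ℕ => c / (x * q ^ n - c)) atTop (𝓝 (c / (x * 0 - c))) :=
      tendsto_const_nhds.div ((hpow.const_mul _).sub tendsto_const_nhds) (by simpa using hc)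
    have e : c / (x * 0 - c) = -1 := by
      rw [mul_zero, zero_sub, div_neg, div_self hc]
    rw [e] at t
    exact t.congr fun n => by rw [zpow_neg, zpow_natCast, div_inv_eq_mul]
  have h1 : HasSum (fun n : ℕ => W n) (1 / (c * (1 - q)) * (c / (x - c) - 0)) := by
    refine (s1.of_norm.hasSum_iff_tendsto_nat).2 ?_
    refine ((tendsto_const_nhds (x := c / (x - c))).sub hG1 |>.const_mul _).congr fun N => ?_
    simp only [htel, ← mul_sum]
    have := sum_range_sub' (fun n : ℕ => c / (x / q ^ (n : ℤ) - c)) N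
    push_cast at this
    rw [this]
    simp
  have s3 : Summable fun n : ℕ => W (-((n : ℤ) + 1)) := by
    have := (summable_nat_add_iff 1).2 s2.of_norm
    simpa using this
  have h2 : HasSum (fun n : ℕ => W (-((n : ℤ) + 1)))
      (1 / (c * (1 - q)) * (-1 - c / (x - c))) := by
    refine (s3.hasSum_iff_tendsto_nat).2 ?_
    refine ((hG2.sub (tendsto_const_nhds (x := c / (x - c)))) |>.const_mul _).congr fun N => ?_
    simp only [htel, ← mul_sum]
    have := sum_range_sub (fun n : ℕ => c / (x / q ^ (-(n : ℤ)) - c)) N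
    push_cast at this
    have e : ∀ n : ℕ, -((n : ℤ) + 1) + 1 = -(n : ℤ) := fun n => by ring
    simp only [e]
    rw [this]
    simp
  rw [(h1.of_nat_of_neg_add_one h2).tsum_eq]
  ring

/-- The two factors (q)_∞ compensate the one in the punctured row and the one hidden in the factor j
= i of the reflected product. -/
theorem prod_theta_div (hq : ‖q‖ < 1) (ha : ∀ i, a i ≠ 0) (i : ι) :
    (∏ j, theta q (a i / b j)) / ∏ j ∈ univ.erase i, theta q (a i / a j) =
      (qPoch q q * qPoch q q) * ((∏ j, qPoch q (q / (a i / b j))) /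
        (∏ j, qPoch q (q / (a i / a j))) * ((∏ j, qPoch q (a i / b j)) /
          ((∏ j ∈ univ.erase i, qPoch q (a i / a j)) * qPoch q q))) := by
  have hqq := qPoch_self_ne_zero hq
  rw [← mul_prod_erase univ (fun j => qPoch q (q / (a i / a j))) (mem_univ i),
    div_self (ha i), div_one]
  simp only [theta, prod_mul_distrib]
  simp only [div_eq_mul_inv (∏ j, _), div_eq_mul_inv (_ * _), mul_inv (∏ j ∈ _, _),
    mul_inv (qPoch q q)]
  field_simp

/-- An elliptic partial fraction identity, obtained from residue sums with N = 2M numerator factors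
per b_j and 2M poles per a_j. The auxiliary c lies on none of the orbits of the a_i and disappears
in the limit. -/
theorem sum_prod_theta_eq_zero (hq : ‖q‖ < 1) (hq0 : q ≠ 0)
    (ha : ∀ i, a i ≠ 0) (hb : ∀ i, b i ≠ 0)
    (hgen : ∀ i j, i ≠ j → ∀ m : ℤ, a i / a j ≠ q ^ m)
    (hbal : ∏ j, a j = ∏ j, b j) :
    ∑ i, (∏ j, theta q (a i / b j)) / ∏ j ∈ univ.erase i, theta q (a i / a j) = 0 := by
  obtain ⟨c, hc, hac⟩ := exists_forall_ne_zpow q a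
  have hq1 : 1 - q ≠ 0 := sub_ne_zero.2 fun h => by rw [← h, norm_one] at hq; exact lt_irrefl _ hq
  have hcgen : ∀ i, ∀ m : ℤ, c / a i ≠ q ^ m := fun i m h => by
    apply hac i (-m)
    rw [zpow_neg, div_inv_eq_mul, ← h, mul_div_cancel₀ _ (ha i)]
  have hca := fun i => qPoch_ne_zero_of_forall_ne hq hq0 (div_ne_zero hc (ha i)) (hcgen i)
  have hb0 : ∏ j, b j ≠ 0 := prod_ne_zero_iff.2 fun j _ => hb j
  -- the residue identity at level `M` uses the extra nodes `c q^{-M}` and `c q^{1-M}`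
  set E : ℕ → ℕ → ℂ := fun u v =>
    ((∏ j, qPochFin q (c / b j) u) * ∏ j, qPochFin q (q / (c / b j)) v) /
      ((∏ j, qPochFin q (c / a j) u) * ∏ j, qPochFin q (q / (c / a j)) v) with hE
  set B : ι → ℕ → ℂ := fun i u => (∏ j, qPochFin q (a i / b j) u) /
    ((∏ j ∈ univ.erase i, qPochFin q (a i / a j) u) * qPochFin q q (u - 1)) with hB
  set A : ι → ℕ → ℂ := fun i n =>
    (∏ j, qPochFin q (q / (a i / b j)) n) / ∏ j, qPochFin q (q / (a i / a j)) n with hA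
  set W : ι → ℤ → ℂ := fun i m =>
    a i / q ^ m / ((a i / q ^ m - c) * (a i / q ^ m - c * q)) with hW
  have hid : ∀ M : ℕ, 1 ≤ M →
      ∑ i, ∑ n ∈ range (2 * M), W i ((n : ℤ) - M) * (A i n * B i (2 * M - n)) =
        (E M M - E (M + 1) (M - 1)) / (c * (1 - q)) := by
    intro M hM
    have hqM := pow_ne_zero M hq0
    obtain ⟨L, rfl⟩ := Nat.exists_eq_add_of_le' hM
    have hqL := pow_ne_zero L hq0
    have hnode : ∀ p : ι × ℕ, ∀ k : ℕ, gridNode q a p ≠ c / q ^ k := fun p k h => by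
      apply hac p.1 ((p.2 : ℤ) - k)
      have h1 := pow_ne_zero p.2 hq0
      have h2 := pow_ne_zero k hq0
      rw [zpow_sub₀ hq0, zpow_natCast, zpow_natCast]
      simp only [gridNode] at h
      field_simp at h ⊢
      exact h
    have key := sum_mul_eval_div_prod_eq_sub (s := grid ι (2 * (L + 1))) (v := gridNode q a)
      (P := gridPoly q b (2 * (L + 1))) (gridNode_injective hq hq0 ha hgen).injOn
      (fun p _ => div_ne_zero (ha _) (pow_ne_zero _ hq0))
      (by rw [card_grid]; exact natDegree_gridPoly_le _ _ _)
      (c := c / q ^ (L + 1)) (d := c / q ^ L) (div_ne_zero hc hqM) (div_ne_zero hc hqL)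
      (fun h => by
        apply hq1
        rw [pow_succ] at h
        field_simp at h
        linear_combination h)
      (fun p _ => hnode p _) (fun p _ => hnode p _)
    have hmon := fun {x : ℂ} (hx : x ≠ 0) n => prod_monomial_div (a := a) (b := b) hq0 hx n
    -- Under this balancing the monomial factors cancel completely.
    simp only [hbal, div_self hb0, one_pow] at hmon
    rw [eval_gridPoly_gridNode hq0 hb hc (by omega), eval_gridPoly_gridNode hq0 hb hc (by omega),
      prod_grid hq0 ha hc (by omega), prod_grid hq0 ha hc (by omega),
      mul_div_mul_comm, mul_div_mul_comm _ _ _ (∏ j, ((c / a j) ^ L * shiftFactor q L)),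
      hmon hc, hmon hc, mul_one, mul_one] at key
    have e1 : 2 * (L + 1) - (L + 1) = L + 1 := by omega
    have e2 : 2 * (L + 1) - L = L + 1 + 1 := by omega
    rw [e1, e2, grid, sum_product] at key
    have e3 : c / q ^ (L + 1) - c / q ^ L = c * (1 - q) / q ^ (L + 1) := by
      rw [pow_succ]
      field_simp
    rw [e3] at key
    have e4 : (E (L + 1) (L + 1) - E (L + 1 + 1) (L + 1 - 1)) / (c * (1 - q)) =
        (q ^ (L + 1))⁻¹ * ((E (L + 1) (L + 1) - E (L + 1 + 1) (L + 1 - 1)) /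
          (c * (1 - q) / q ^ (L + 1))) := by
      field_simp
    rw [e4]
    simp only [hE, Nat.add_sub_cancel]
    rw [← key, mul_sum]
    refine sum_congr rfl fun i _ => ?_
    rw [mul_sum]
    refine sum_congr rfl fun n hn => ?_
    have hn' := mem_range.1 hn
    have hqn := pow_ne_zero n hq0
    -- The weight is homogeneous of degree -1, so scaling by q^M moves the auxiliary poles to c and
    -- c q.
    have hWn : W i ((n : ℤ) - (L + 1 : ℕ)) = (q ^ (L + 1))⁻¹ * (gridNode q a (i, n) /
        ((gridNode q a (i, n) - c / q ^ (L + 1)) * (gridNode q a (i, n) - c / q ^ L))) := by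
      have h1 := sub_ne_zero.2 (hnode (i, n) (L + 1))
      have h2 := sub_ne_zero.2 (hnode (i, n) L)
      have f1 : a i / q ^ ((n : ℤ) - (L + 1 : ℕ)) = gridNode q a (i, n) * q ^ (L + 1) := by
        rw [zpow_sub₀ hq0, zpow_natCast, zpow_natCast, gridNode]
        field_simp
      have f2 : gridNode q a (i, n) * q ^ (L + 1) - c =
          q ^ (L + 1) * (gridNode q a (i, n) - c / q ^ (L + 1)) := by
        field_simp
      have f3 : gridNode q a (i, n) * q ^ (L + 1) - c * q =
          q ^ (L + 1) * (gridNode q a (i, n) - c / q ^ L) := by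
        rw [pow_succ]
        field_simp
      simp only [hW]
      rw [f1, f2, f3]
      generalize gridNode q a (i, n) - c / q ^ (L + 1) = y at *
      generalize gridNode q a (i, n) - c / q ^ L = z at *
      field_simp
    have hg : gridNode q a (i, n) = a i / q ^ n := rfl
    rw [← grid, prod_grid_erase hq0 ha i hn', ← mul_assoc (q ^ (L + 1))⁻¹, ← hWn, hg,
      eval_gridPoly_gridNode hq0 hb (ha i) hn'.le,
      mul_mul_div_mul_mul, hmon (ha i)]
    have e5 : 2 * (L + 1) - 1 - n = 2 * (L + 1) - n - 1 := by omega
    simp only [hA, hB, e5, one_mul]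
  have hElim : ∀ u v : ℕ → ℕ, Tendsto u atTop atTop → Tendsto v atTop atTop →
      Tendsto (fun M => E (u M) (v M)) atTop (𝓝 (
        ((∏ j, qPoch q (c / b j)) * ∏ j, qPoch q (q / (c / b j))) /
        ((∏ j, qPoch q (c / a j)) * ∏ j, qPoch q (q / (c / a j))))) := fun u v hu hv =>
    ((tendsto_finsetProd _ fun j _ => (tendsto_qPochFin hq _).comp hu).mul
      (tendsto_finsetProd _ fun j _ => (tendsto_qPochFin hq _).comp hv)).div
    ((tendsto_finsetProd _ fun j _ => (tendsto_qPochFin hq _).comp hu).mul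
      (tendsto_finsetProd _ fun j _ => (tendsto_qPochFin hq _).comp hv))
    (mul_ne_zero (prod_ne_zero_iff.2 fun j _ => (hca j).1)
      (prod_ne_zero_iff.2 fun j _ => (hca j).2))
  have hBlim : ∀ i, Tendsto (B i) atTop (𝓝 ((∏ j, qPoch q (a i / b j)) /
      ((∏ j ∈ univ.erase i, qPoch q (a i / a j)) * qPoch q q))) := fun i =>
    (tendsto_finsetProd _ fun j _ => tendsto_qPochFin hq _).div
      ((tendsto_finsetProd _ fun j _ => tendsto_qPochFin hq _).mul
        ((tendsto_qPochFin hq _).comp (tendsto_sub_atTop_nat 1)))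
      (mul_ne_zero (prod_erase_qPoch_ne_zero hq hq0 ha hgen i) (qPoch_self_ne_zero hq))
  have hweight := fun i => hasSum_bilateral_weight hq hq0 (ha i) hc (hac i)
  have hL := tendsto_finsetSum univ fun i _ => tendsto_sum_range_bilateral (hweight i).1
    (tendsto_head (b := b) hq hq0 ha hgen i) (hBlim i)
  -- Both auxiliary residue terms have the same limit, so the right side tends to 0.
  have hR := ((hElim _ _ tendsto_id tendsto_id).sub (hElim _ _ (tendsto_add_atTop_nat 1)
    (tendsto_sub_atTop_nat 1))).div_const (c * (1 - q))
  rw [sub_self, zero_div] at hR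
  have h0 := tendsto_nhds_unique hL (hR.congr' (by
    filter_upwards [eventually_ge_atTop 1] with M hM
    exact (hid M hM).symm))
  -- Every row has the same nonzero weight sum, which therefore factors out.
  simp only [fun i => (hweight i).2] at h0
  rw [← mul_sum] at h0
  have h1 := (mul_eq_zero.1 h0).resolve_left
    (neg_ne_zero.2 (one_div_ne_zero (mul_ne_zero hc hq1)))
  rw [sum_congr rfl fun i _ => prod_theta_div hq ha i, ← mul_sum, h1, mul_zero]

end Residues

/-! ### Jackson integrals of quotients of q-shifted factorials. -/

/-- The quotient `∏_j (a_j s)_∞ / (b_j s)_∞`. -/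
noncomputable def qPochQuot {ι : Type*} [Fintype ι] (q : ℂ) (a b : ι → ℂ) (s : ℂ) : ℂ :=
  (∏ j, qPoch q (a j * s)) / ∏ j, qPoch q (b j * s)

section Quotient

variable {ι : Type*} [Fintype ι] {q : ℂ} {a b : ι → ℂ}

theorem summable_qPochQuot (hq : ‖q‖ < 1) {τ : ℂ} (hτ : ∏ j, qPoch q (b j * τ) ≠ 0) :
    Summable fun n : ℕ => qPochQuot q a b (τ * q ^ n) * (τ * q ^ n) := by
  choose C hC using fun j => exists_norm_qPoch_mul_pow_le hq (a j * τ)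
  choose D hD using fun j => exists_norm_inv_qPoch_mul_pow_le hq (prod_ne_zero_iff.1 hτ j (mem_univ j))
  have hbound : ∀ n : ℕ, ‖qPochQuot q a b (τ * q ^ n) * τ‖ ≤ ((∏ j, C j) * ∏ j, D j) * ‖τ‖ := by
    intro n
    have h0 : 0 ≤ ∏ j, C j := prod_nonneg fun j _ => (norm_nonneg _).trans (hC j 0)
    rw [norm_mul, qPochQuot, div_eq_mul_inv, norm_mul, ← prod_inv_distrib, norm_prod, norm_prod]
    simp only [← mul_assoc]
    gcongr with j _ j _
    · exact hC j n
    · exact hD j n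
  refine (summable_norm_pow_mul hq hbound).of_norm.congr fun n => ?_
  ring

theorem jacksonZero_mul_pow {f : ℂ → ℂ} {τ : ℂ} {k : ℕ}
    (hs : Summable fun n : ℕ => f (τ * q ^ n) * (τ * q ^ n))
    (h0 : ∀ n < k, f (τ * q ^ n) = 0) : jacksonZero q f (τ * q ^ k) = jacksonZero q f τ := by
  rw [jacksonZero, jacksonZero, ← hs.sum_add_tsum_nat_add k,
    sum_eq_zero fun n hn => by rw [h0 n (mem_range.1 hn), zero_mul], zero_add]
  congr 2
  ext n
  rw [pow_add, mul_assoc τ, mul_comm (q ^ k)]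

theorem qPochQuot_eq_zero (hq : ‖q‖ < 1) {s : ℂ} (j : ι) (k : ℕ) (h : a j * s * q ^ k = 1) :
    qPochQuot q a b s = 0 := by
  rw [qPochQuot, prod_eq_zero (mem_univ j) ((qPoch_eq_zero_iff hq).2 ⟨k, h⟩), zero_div]

/-- Splitting (a_j q/a_i)_∞ after n factors, and likewise for b_j, shows that the integrand at
q^{n+1}/a_i is a constant times the ratio of finite factorials in `sum_unilateral_eq_zero`. With
that constant, the rest of the theta quotient matches by `prod_theta_div`. -/
theorem sum_theta_mul_jacksonZero_eq_zero [DecidableEq ι] (hq : ‖q‖ < 1) (hq0 : q ≠ 0)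
    (hι : 2 ≤ Fintype.card ι) (ha : ∀ i, a i ≠ 0) (hb : ∀ i, b i ≠ 0)
    (hgen : ∀ i j, i ≠ j → ∀ m : ℤ, a i / a j ≠ q ^ m)
    (hbal : ∏ j, a j = q ^ 2 * ∏ j, b j)
    (hpole : ∀ i, ∀ n : ℕ, ∏ j, qPoch q (b j * (q / a i * q ^ n)) ≠ 0) :
    ∑ i, a i ^ 2 * ((∏ j, theta q (a i / b j)) / ∏ j ∈ univ.erase i, theta q (a i / a j)) *
      jacksonZero q (qPochQuot q a b) (q / a i) = 0 := by
  have hsum := sum_unilateral_eq_zero hq hq0 hι ha hb hgen hbal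
  have hterm : ∀ i, a i ^ 2 *
      ((∏ j, theta q (a i / b j)) / ∏ j ∈ univ.erase i, theta q (a i / a j)) *
      jacksonZero q (qPochQuot q a b) (q / a i) =
      (1 - q) * q * (qPoch q q * qPoch q q) *
      (a i * ((∑' n : ℕ, q ^ n * ((∏ j, qPochFin q (q / (a i / b j)) n) /
        ∏ j, qPochFin q (q / (a i / a j)) n)) *
      ((∏ j, qPoch q (a i / b j)) /
        ((∏ j ∈ univ.erase i, qPoch q (a i / a j)) * qPoch q q)))) := by
    intro i
    have hai := ha i
    have hA : ∏ j, qPoch q (q / (a i / a j)) ≠ 0 := prod_ne_zero_iff.2 fun j _ => by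
      by_cases hij : i = j
      · subst hij
        rw [div_self (ha i), div_one]
        exact qPoch_self_ne_zero hq
      · exact (qPoch_ne_zero_of_forall_ne hq hq0 (div_ne_zero (ha i) (ha j)) (hgen i j hij)).2
    have hsplit : ∀ (c : ι → ℂ) (n : ℕ), (∀ j, c j ≠ 0) →
        ∏ j, qPoch q (q / (a i / c j)) =
          (∏ j, qPochFin q (q / (a i / c j)) n) * ∏ j, qPoch q (c j * (q / a i * q ^ n)) := by
      intro c n hc
      rw [← prod_mul_distrib]
      refine prod_congr rfl fun j _ => ?_
      have := hc j
      rw [qPoch_eq_mul hq _ n]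
      congr 2
      field_simp
    have hhead : ∀ n : ℕ, (∏ j, qPoch q (q / (a i / b j))) / (∏ j, qPoch q (q / (a i / a j))) *
        (qPochQuot q a b (q / a i * q ^ n) * (q / a i * q ^ n)) =
        q / a i * (q ^ n * ((∏ j, qPochFin q (q / (a i / b j)) n) /
        ∏ j, qPochFin q (q / (a i / a j)) n)) := by
      intro n
      have hp := hpole i n
      have h1 := hsplit a n ha
      rw [h1] at hA
      obtain ⟨hA1, hA2⟩ := mul_ne_zero_iff.1 hA
      rw [hsplit b n hb, h1, qPochQuot]
      generalize ∏ j, qPoch q (b j * (q / a i * q ^ n)) = u at *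
      generalize ∏ j, qPoch q (a j * (q / a i * q ^ n)) = v at *
      generalize ∏ j, qPochFin q (q / (a i / a j)) n = w at *
      field_simp
    rw [prod_theta_div hq ha i, jacksonZero]
    have h2 : (∏ j, qPoch q (q / (a i / b j))) / (∏ j, qPoch q (q / (a i / a j))) *
        ∑' n : ℕ, qPochQuot q a b (q / a i * q ^ n) * (q / a i * q ^ n) =
        q / a i * ∑' n : ℕ, q ^ n * ((∏ j, qPochFin q (q / (a i / b j)) n) /
        ∏ j, qPochFin q (q / (a i / a j)) n) := by
      rw [← tsum_mul_left, ← tsum_mul_left]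
      exact tsum_congr hhead
    generalize (∏ j, qPoch q (a i / b j)) /
        ((∏ j ∈ univ.erase i, qPoch q (a i / a j)) * qPoch q q) = T at *
    generalize (∏ j, qPoch q (q / (a i / b j))) / (∏ j, qPoch q (q / (a i / a j))) = H at *
    generalize ∑' n : ℕ, q ^ n * ((∏ j, qPochFin q (q / (a i / b j)) n) /
        ∏ j, qPochFin q (q / (a i / a j)) n) = S at *
    have h3 : a i ^ 2 * (q / a i * S) = q * a i * S := by field_simp
    linear_combination (a i ^ 2 * (qPoch q q * qPoch q q) * T * (1 - q)) * h2 +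
      (qPoch q q * qPoch q q) * T * (1 - q) * h3
  rw [sum_congr rfl fun i _ => hterm i, ← mul_sum, hsum, mul_zero]

/-- The orbit of q/a_i is the orbit of q/a_j without its first k points, and at those the factor
(a_i s)_∞ vanishes. -/
theorem jacksonZero_eq_of_eq_mul_pow (hq : ‖q‖ < 1) (hq0 : q ≠ 0) (ha : ∀ i, a i ≠ 0)
    (hpole : ∀ i, ∏ j, qPoch q (b j * (q / a i)) ≠ 0) {i j : ι} {k : ℕ}
    (h : a j = a i * q ^ k) :
    jacksonZero q (qPochQuot q a b) (q / a i) = jacksonZero q (qPochQuot q a b) (q / a j) := by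
  have hai := ha i
  have hk := pow_ne_zero k hq0
  have e : q / a i = q / a j * q ^ k := by
    rw [h]
    field_simp
  rw [e]
  refine jacksonZero_mul_pow (summable_qPochQuot hq (hpole j)) fun n hn =>
    qPochQuot_eq_zero hq i (k - 1 - n) ?_
  have hkn : k = n + 1 + (k - 1 - n) := by omega
  rw [h]
  generalize k - 1 - n = r at *
  subst hkn
  rw [pow_add, pow_add]
  field_simp

theorem jacksonZero_eq_of_theta_eq_zero (hq : ‖q‖ < 1) (hq0 : q ≠ 0) (ha : ∀ i, a i ≠ 0)
    (hpole : ∀ i, ∏ j, qPoch q (b j * (q / a i)) ≠ 0) {i j : ι} (h : theta q (a i / a j) = 0) :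
    jacksonZero q (qPochQuot q a b) (q / a i) = jacksonZero q (qPochQuot q a b) (q / a j) := by
  obtain ⟨m, hm⟩ := (theta_eq_zero_iff hq hq0 (div_ne_zero (ha i) (ha j))).1 h
  rw [div_eq_iff (ha j)] at hm
  obtain ⟨k, rfl | rfl⟩ := m.eq_nat_or_neg
  · refine (jacksonZero_eq_of_eq_mul_pow hq hq0 ha hpole (k := k) ?_).symm
    rw [hm, zpow_natCast, mul_comm]
  · refine jacksonZero_eq_of_eq_mul_pow hq hq0 ha hpole (k := k) ?_
    have := pow_ne_zero k hq0
    rw [hm, zpow_neg, zpow_natCast]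
    field_simp

end Quotient

/-! ### The theta relation for four parameters. -/

theorem theta_div_q {q : ℂ} (hq : ‖q‖ < 1) (hq0 : q ≠ 0) {z : ℂ} (hz : z ≠ 0) :
    theta q (z / q) = -(z / q) * theta q z := by
  have h := theta_q_mul hq hq0 (div_ne_zero hz hq0)
  rw [mul_div_cancel₀ _ hq0] at h
  rw [h]
  field_simp

/-- Replacing two of the b_j by q b_j absorbs the q² of the balancing; each replacement costs a
factor -a_i/(q b_j), and the two together produce a_i². -/
theorem sum_sq_mul_theta_eq_zero {q : ℂ} {a b : Fin 4 → ℂ} (hq : ‖q‖ < 1) (hq0 : q ≠ 0)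
    (ha : ∀ i, a i ≠ 0) (hb : ∀ i, b i ≠ 0)
    (hgen : ∀ i j, i ≠ j → ∀ m : ℤ, a i / a j ≠ q ^ m)
    (hbal : ∏ j, a j = q ^ 2 * ∏ j, b j) :
    ∑ i, a i ^ 2 * ((∏ j, theta q (a i / b j)) / ∏ j ∈ univ.erase i, theta q (a i / a j)) = 0 := by
  have hb0 := hb 0
  have hb1 := hb 1
  have h := sum_prod_theta_eq_zero (b := ![q * b 0, q * b 1, b 2, b 3]) hq hq0 ha
    (by
      intro i
      fin_cases i
      exacts [mul_ne_zero hq0 hb0, mul_ne_zero hq0 hb1, hb 2, hb 3]) hgen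
    (by
      rw [hbal]
      simp only [Fin.prod_univ_four, Matrix.cons_val]
      ring)
  have hterm : ∀ i, a i ^ 2 *
      ((∏ j, theta q (a i / b j)) / ∏ j ∈ univ.erase i, theta q (a i / a j)) =
      q ^ 2 * (b 0 * b 1) * ((∏ j, theta q (a i / ![q * b 0, q * b 1, b 2, b 3] j)) /
        ∏ j ∈ univ.erase i, theta q (a i / a j)) := by
    intro i
    have e : ∀ z : ℂ, z ≠ 0 → theta q (a i / (q * z)) = -(a i / z / q) * theta q (a i / z) :=
      fun z hz => by rw [← theta_div_q hq hq0 (div_ne_zero (ha i) hz), div_div, mul_comm z]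
    rw [mul_div_assoc', mul_div_assoc']
    congr 1
    simp only [Fin.prod_univ_four, Matrix.cons_val]
    rw [e _ hb0, e _ hb1]
    field_simp
  rw [sum_congr rfl fun i _ => hterm i, ← mul_sum, h, mul_zero]

/-! ### Translation between the original parameters and a_i, b_i. -/

/-- The numerator parameters `a_i = q^{h_i+1/2} t_i` (`i = 1, 2, 3`), `a_4 = q^ν x`. -/
noncomputable def numPar (q ν : ℂ) (h t : Fin 3 → ℂ) (x : ℂ) : Fin 4 → ℂ :=
  ![q ^ (h 0 + 1 / 2) * t 0, q ^ (h 1 + 1 / 2) * t 1, q ^ (h 2 + 1 / 2) * t 2, q ^ ν * x]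

/-- The denominator parameters `b_i = q^{ν+l_i-1/2} t_i` (`i = 1, 2, 3`), `b_4 = x`. -/
noncomputable def denPar (q ν : ℂ) (l t : Fin 3 → ℂ) (x : ℂ) : Fin 4 → ℂ :=
  ![q ^ (ν + l 0 - 1 / 2) * t 0, q ^ (ν + l 1 - 1 / 2) * t 1, q ^ (ν + l 2 - 1 / 2) * t 2, x]

/-- The value of the coefficient `C_i` in terms of the parameters, where `i, j, k` are the indices
of the first three parameters. -/
noncomputable def coeffVal (q : ℂ) (a b : Fin 4 → ℂ) (i j k : Fin 4) : ℂ :=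
  theta q (a i / b i) * theta q (a i / b j) * theta q (a i / b k) *
      theta q (q * (q * (b 3 / a i))) * theta q (a 3 / a j) * theta q (a 3 / a k) /
    (theta q (a 3 / b 3 / q) * theta q (a i / a j) * theta q (a i / a k) *
      theta q (a 3 / b i) * theta q (a 3 / b j) * theta q (a 3 / b k))

section Parameters

variable {q ν x : ℂ} {h l t : Fin 3 → ℂ}

theorem numPar_ne_zero (hq0 : q ≠ 0) (ht : ∀ i, t i ≠ 0) (hx : x ≠ 0) (i : Fin 4) :
    numPar q ν h t x i ≠ 0 := by
  fin_cases i <;> simp [numPar, hq0, ht, hx]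

theorem denPar_ne_zero (hq0 : q ≠ 0) (ht : ∀ i, t i ≠ 0) (hx : x ≠ 0) (i : Fin 4) :
    denPar q ν l t x i ≠ 0 := by
  fin_cases i <;> simp [denPar, hq0, ht, hx]

theorem integrandNum_eq (s : ℂ) :
    integrandNum q ν h t x s = ∏ j, qPoch q (numPar q ν h t x j * s) := by
  simp only [integrandNum, numPar, Fin.prod_univ_four, Fin.prod_univ_three, Matrix.cons_val]
  ring

theorem integrandDen_eq (s : ℂ) :
    integrandDen q ν l t x s = ∏ j, qPoch q (denPar q ν l t x j * s) := by
  simp only [integrandDen, denPar, Fin.prod_univ_four, Fin.prod_univ_three, Matrix.cons_val]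
  ring

theorem integrand_eq :
    integrand q ν h l t x = qPochQuot q (numPar q ν h t x) (denPar q ν l t x) := by
  ext s
  rw [integrand, integrandNum_eq, integrandDen_eq, qPochQuot]

theorem node_three (hq0 : q ≠ 0) : node q ν h t x 3 = q / numPar q ν h t x 3 := by
  simp only [node, numPar, Matrix.cons_val]
  rw [Complex.cpow_sub _ _ hq0, Complex.cpow_one, div_div]

theorem node_castSucc (i : Fin 3) :
    node q ν h t x i.castSucc = 1 / numPar q ν h t x i.castSucc := by
  have e : ∀ z w : ℂ, q ^ (-z - 1 / 2) / w = 1 / (q ^ (z + 1 / 2) * w) := fun z w => by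
    rw [← neg_add', Complex.cpow_neg, one_div (_ * w), mul_inv, div_eq_mul_inv]
  fin_cases i <;> exact e _ _

theorem prod_numPar (hq0 : q ≠ 0)
    (hν : q ^ (2 * ν) = q ^ (h 0 + h 1 + h 2 - l 0 - l 1 - l 2 + 1)) :
    ∏ j, numPar q ν h t x j = q ^ 2 * ∏ j, denPar q ν l t x j := by
  have e1 : q ^ (h 0 + 1 / 2) * q ^ (h 1 + 1 / 2) * q ^ (h 2 + 1 / 2) * q ^ ν =
      q ^ (2 : ℂ) * (q ^ (ν + l 0 - 1 / 2) * q ^ (ν + l 1 - 1 / 2) * q ^ (ν + l 2 - 1 / 2)) := by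
    -- The hypothesis equates powers of q, not exponents, so its right side is isolated as a factor
    -- before rewriting.
    have e2 : q ^ (h 0 + 1 / 2) * q ^ (h 1 + 1 / 2) * q ^ (h 2 + 1 / 2) * q ^ ν =
        q ^ (h 0 + h 1 + h 2 - l 0 - l 1 - l 2 + 1) * q ^ (l 0 + l 1 + l 2 + 1 / 2 + ν) := by
      simp only [← Complex.cpow_add _ _ hq0]
      congr 1
      ring
    rw [e2, ← hν]
    simp only [← Complex.cpow_add _ _ hq0]
    congr 1
    ring
  rw [Complex.cpow_ofNat] at e1
  simp only [numPar, denPar, Fin.prod_univ_four, Matrix.cons_val]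
  linear_combination t 0 * t 1 * t 2 * x * e1

theorem coeffNum_eq_and_coeffDen_eq (hq0 : q ≠ 0) (ht : ∀ i, t i ≠ 0) (hx : x ≠ 0) :
    coeffNum q ν h l t x =
      theta q (numPar q ν h t x 0 / denPar q ν l t x 0) *
      theta q (numPar q ν h t x 0 / denPar q ν l t x 1) *
      theta q (numPar q ν h t x 0 / denPar q ν l t x 2) *
      theta q (q * (q * (denPar q ν l t x 3 / numPar q ν h t x 0))) *
      theta q (numPar q ν h t x 3 / numPar q ν h t x 1) *
      theta q (numPar q ν h t x 3 / numPar q ν h t x 2) ∧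
    coeffDen q ν h l t x =
      theta q (numPar q ν h t x 3 / denPar q ν l t x 3 / q) *
      theta q (numPar q ν h t x 0 / numPar q ν h t x 1) *
      theta q (numPar q ν h t x 0 / numPar q ν h t x 2) *
      theta q (numPar q ν h t x 3 / denPar q ν l t x 0) *
      theta q (numPar q ν h t x 3 / denPar q ν l t x 1) *
      theta q (numPar q ν h t x 3 / denPar q ν l t x 2) := by
  have e1 : ∀ i j : Fin 3, q ^ (h i + 1 / 2) * t i / (q ^ (ν + l j - 1 / 2) * t j) =
      t i * q ^ (h i - l j - ν + 1) / t j := fun i j => by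
    have : h i - l j - ν + 1 = (h i + 1 / 2) - (ν + l j - 1 / 2) := by ring
    rw [this, Complex.cpow_sub (h i + 1 / 2) _ hq0]
    ring
  have e1' : q ^ (h 0 + 1 / 2) * t 0 / (q ^ (ν + l 0 - 1 / 2) * t 0) =
      q ^ (h 0 - l 0 - ν + 1) := by
    rw [e1, mul_div_cancel_left₀ _ (ht 0)]
  have e2 : ∀ i j : Fin 3, q ^ (h i + 1 / 2) * t i / (q ^ (h j + 1 / 2) * t j) =
      t i * q ^ (h i - h j) / t j := fun i j => by
    have : h i - h j = (h i + 1 / 2) - (h j + 1 / 2) := by ring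
    rw [this, Complex.cpow_sub _ _ hq0]
    ring
  have e3 : q * (q * (x / (q ^ (h 0 + 1 / 2) * t 0))) = x * q ^ (3 / 2 - h 0) / t 0 := by
    have : 3 / 2 - h 0 = 2 - (h 0 + 1 / 2) := by ring
    rw [this, Complex.cpow_sub _ _ hq0, Complex.cpow_ofNat]
    ring
  have e4 : ∀ i : Fin 3, q ^ ν * x / (q ^ (h i + 1 / 2) * t i) =
      x * q ^ (-h i + ν - 1 / 2) / t i := fun i => by
    have : -h i + ν - 1 / 2 = ν - (h i + 1 / 2) := by ring
    rw [this, Complex.cpow_sub _ _ hq0]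
    ring
  have e5 : ∀ i : Fin 3, q ^ ν * x / (q ^ (ν + l i - 1 / 2) * t i) =
      x * q ^ (1 / 2 - l i) / t i := fun i => by
    have : 1 / 2 - l i = ν - (ν + l i - 1 / 2) := by ring
    rw [this, Complex.cpow_sub ν _ hq0]
    ring
  have e6 : q ^ ν * x / x / q = q ^ (ν - 1) := by
    rw [Complex.cpow_sub _ _ hq0, Complex.cpow_one, mul_div_cancel_right₀ _ hx]
  simp only [numPar, denPar, Matrix.cons_val, e1', e1, e2, e3, e4, e5, e6, coeffNum, coeffDen,
    and_self]

theorem coeffNum_div_coeffDen (hq0 : q ≠ 0) (ht : ∀ i, t i ≠ 0) (hx : x ≠ 0) :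
    coeffNum q ν h l t x / coeffDen q ν h l t x =
      coeffVal q (numPar q ν h t x) (denPar q ν l t x) 0 1 2 := by
  obtain ⟨h1, h2⟩ := coeffNum_eq_and_coeffDen_eq (ν := ν) (h := h) (l := l) hq0 ht hx
  rw [h1, h2, coeffVal]

theorem exch_zero (v : Fin 3 → ℂ) : exch 0 v = v := by
  ext i
  simp [exch]

theorem coeff_zero (hq0 : q ≠ 0) (ht : ∀ i, t i ≠ 0) (hx : x ≠ 0) :
    coeff q ν h l t x 0 = coeffVal q (numPar q ν h t x) (denPar q ν l t x) 0 1 2 := by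
  simp only [coeff, exch_zero, coeffNum_div_coeffDen hq0 ht hx]

theorem exch_one (v : Fin 3 → ℂ) : exch 1 v = ![v 1, v 0, v 2] := by
  ext i; fin_cases i <;> rfl

theorem exch_two (v : Fin 3 → ℂ) : exch 2 v = ![v 2, v 1, v 0] := by
  ext i; fin_cases i <;> rfl

theorem coeff_one (hq0 : q ≠ 0) (ht : ∀ i, t i ≠ 0) (hx : x ≠ 0) :
    coeff q ν h l t x 1 = coeffVal q (numPar q ν h t x) (denPar q ν l t x) 1 0 2 := by
  rw [coeff, coeffNum_div_coeffDen (t := exch 1 t) hq0 (fun _ => ht _) hx]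
  simp only [exch_one, coeffVal, numPar, denPar, Matrix.cons_val]

theorem coeff_two (hq0 : q ≠ 0) (ht : ∀ i, t i ≠ 0) (hx : x ≠ 0) :
    coeff q ν h l t x 2 = coeffVal q (numPar q ν h t x) (denPar q ν l t x) 2 1 0 := by
  rw [coeff, coeffNum_div_coeffDen (t := exch 2 t) hq0 (fun _ => ht _) hx]
  simp only [exch_two, coeffVal, numPar, denPar, Matrix.cons_val]

end Parameters

/-! ### Elimination of the fourth integral. -/

/-- Reflection and quasi-periodicity bring the thetas in a_i/b_3 and a_i/a_3 to the form used in C.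
The remaining prefactor is symmetric in i, j, k, hence common to the three coefficients. -/
theorem coeffVal_eq {q : ℂ} {a b : Fin 4 → ℂ} (hq : ‖q‖ < 1) (hq0 : q ≠ 0)
    (ha : ∀ i, a i ≠ 0) (hb : ∀ i, b i ≠ 0) {i j k : Fin 4}
    (hi : theta q (a 3 / a i) ≠ 0) (hj : theta q (a 3 / a j) ≠ 0) (hk : theta q (a 3 / a k) ≠ 0)
    (h0 : theta q (a 3 / b 3 / q) ≠ 0) (h1 : theta q (a 3 / b i) ≠ 0)
    (h2 : theta q (a 3 / b j) ≠ 0) (h3 : theta q (a 3 / b k) ≠ 0) :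
    a i ^ 2 * (theta q (a i / b i) * theta q (a i / b j) * theta q (a i / b k) *
      theta q (a i / b 3) / (theta q (a i / a j) * theta q (a i / a k) * theta q (a i / a 3))) =
    q * b 3 * a 3 * theta q (a 3 / b 3 / q) *
      (theta q (a 3 / b i) * theta q (a 3 / b j) * theta q (a 3 / b k)) /
      (theta q (a 3 / a i) * theta q (a 3 / a j) * theta q (a 3 / a k)) *
      coeffVal q a b i j k := by
  have hai := ha i
  have ha3 := ha 3
  have hb3 := hb 3
  have e1 : theta q (q * (q * (b 3 / a i))) = -(a i / (q * b 3)) * theta q (a i / b 3) := by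
    rw [theta_q_mul hq hq0 (mul_ne_zero hq0 (div_ne_zero hb3 hai)), ← theta_q_div q hq0]
    have : q / (q * (b 3 / a i)) = a i / b 3 := by field_simp
    rw [this]
    field_simp
  have e2 : theta q (a i / a 3) = -(a i / a 3) * theta q (a 3 / a i) := by
    have : q / (a i / a 3) = q * (a 3 / a i) := by field_simp
    rw [← theta_q_div q hq0, this, theta_q_mul hq hq0 (div_ne_zero ha3 hai)]
    field_simp
  rw [coeffVal, e1, e2]
  generalize theta q (a i / a j) = u
  generalize theta q (a 3 / b 3 / q) = w at *
  generalize theta q (a i / a k) = v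
  simp only [div_eq_mul_inv _ (_ * _), mul_inv]
  field_simp

theorem prod_erase_fin_four (f : Fin 4 → ℂ) :
    ∏ j ∈ univ.erase 0, f j = f 1 * f 2 * f 3 ∧ ∏ j ∈ univ.erase 1, f j = f 0 * f 2 * f 3 ∧
      ∏ j ∈ univ.erase 2, f j = f 1 * f 0 * f 3 := by
  have e0 : (univ.erase 0 : Finset (Fin 4)) = {1, 2, 3} := by decide
  have e1 : (univ.erase 1 : Finset (Fin 4)) = {0, 2, 3} := by decide
  have e2 : (univ.erase 2 : Finset (Fin 4)) = {1, 0, 3} := by decide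
  rw [e0, e1, e2]
  simp [mul_assoc]

theorem theta_div_eq_zero_comm {q a b : ℂ} (hq : ‖q‖ < 1) (hq0 : q ≠ 0) (ha : a ≠ 0) (hb : b ≠ 0)
    (h : theta q (a / b) = 0) : theta q (b / a) = 0 := by
  obtain ⟨m, hm⟩ := (theta_eq_zero_iff hq hq0 (div_ne_zero ha hb)).1 h
  exact (theta_eq_zero_iff hq hq0 (div_ne_zero hb ha)).2 ⟨-m, by rw [zpow_neg, ← hm, inv_div]⟩

theorem sum_coeffVal_mul_eq_zero {q : ℂ} {a b : Fin 4 → ℂ} (hq : ‖q‖ < 1) (hq0 : q ≠ 0)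
    (ha : ∀ i, a i ≠ 0) (hb : ∀ i, b i ≠ 0)
    (hbal : ∏ j, a j = q ^ 2 * ∏ j, b j)
    (hpole : ∀ i, ∏ j, qPoch q (b j * (q / a i)) ≠ 0)
    (h01 : theta q (a 0 / a 1) ≠ 0) (h02 : theta q (a 0 / a 2) ≠ 0)
    (h12 : theta q (a 1 / a 2) ≠ 0) (hb0 : theta q (a 3 / b 0) ≠ 0)
    (hb1 : theta q (a 3 / b 1) ≠ 0) (hb2 : theta q (a 3 / b 2) ≠ 0)
    (hb3 : theta q (a 3 / b 3 / q) ≠ 0) :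
    coeffVal q a b 0 1 2 *
        (jacksonZero q (qPochQuot q a b) (q / a 3) - jacksonZero q (qPochQuot q a b) (q / a 0)) +
      coeffVal q a b 1 0 2 *
        (jacksonZero q (qPochQuot q a b) (q / a 3) - jacksonZero q (qPochQuot q a b) (q / a 1)) +
      coeffVal q a b 2 1 0 *
        (jacksonZero q (qPochQuot q a b) (q / a 3) - jacksonZero q (qPochQuot q a b) (q / a 2)) =
      0 := by
  have hdeg : ∀ i, theta q (a 3 / a i) = 0 →
      jacksonZero q (qPochQuot q a b) (q / a 3) = jacksonZero q (qPochQuot q a b) (q / a i) :=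
    fun i h => jacksonZero_eq_of_theta_eq_zero hq hq0 ha hpole h
  -- If a_3/a_0 is a power of q, the two integrals in the first difference agree, and the other two
  -- coefficients contain θ(a_3/a_0) = 0. The next two cases are analogous.
  by_cases h30 : theta q (a 3 / a 0) = 0
  · rw [hdeg 0 h30]
    simp [coeffVal, h30]
  by_cases h31 : theta q (a 3 / a 1) = 0
  · rw [hdeg 1 h31]
    simp [coeffVal, h31]
  by_cases h32 : theta q (a 3 / a 2) = 0
  · rw [hdeg 2 h32]
    simp [coeffVal, h32]
  have hne : ∀ i j, i ≠ j → theta q (a i / a j) ≠ 0 := by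
    have hc : ∀ i j, theta q (a i / a j) ≠ 0 → theta q (a j / a i) ≠ 0 := fun i j h h' =>
      h (theta_div_eq_zero_comm hq hq0 (ha j) (ha i) h')
    intro i j hij
    fin_cases i <;> fin_cases j <;> first
      | exact absurd rfl hij
      | assumption
      | exact hc _ _ (by assumption)
  have hgen : ∀ i j, i ≠ j → ∀ m : ℤ, a i / a j ≠ q ^ m := fun i j hij m hm =>
    hne i j hij ((theta_eq_zero_iff hq hq0 (div_ne_zero (ha i) (ha j))).2 ⟨m, hm⟩)
  have s1 := sum_theta_mul_jacksonZero_eq_zero hq hq0 (by simp) ha hb hgen hbal fun i n =>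
    prod_ne_zero_iff.2 fun j _ h => by
      have := prod_ne_zero_iff.1 (hpole i) j (mem_univ j)
      rw [qPoch_eq_mul hq _ n, mul_assoc (b j), h, mul_zero] at this
      exact this rfl
  have s2 := sum_sq_mul_theta_eq_zero hq hq0 ha hb hgen hbal
  rw [Fin.sum_univ_four] at s1 s2
  obtain ⟨p0, -, -⟩ := prod_erase_fin_four fun j => theta q (a 0 / a j)
  obtain ⟨-, p1, -⟩ := prod_erase_fin_four fun j => theta q (a 1 / a j)
  obtain ⟨-, -, p2⟩ := prod_erase_fin_four fun j => theta q (a 2 / a j)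
  have c0 := coeffVal_eq hq hq0 ha hb h30 h31 h32 hb3 hb0 hb1 hb2
  have c1 := coeffVal_eq hq hq0 ha hb h31 h30 h32 hb3 hb1 hb0 hb2
  have c2 := coeffVal_eq hq hq0 ha hb h32 h31 h30 hb3 hb2 hb1 hb0
  rw [← p0] at c0
  rw [← p1] at c1
  rw [← p2] at c2
  have r0 : ∏ j, theta q (a 0 / b j) = theta q (a 0 / b 0) * theta q (a 0 / b 1) *
      theta q (a 0 / b 2) * theta q (a 0 / b 3) := Fin.prod_univ_four _
  have r1 : ∏ j, theta q (a 1 / b j) = theta q (a 1 / b 1) * theta q (a 1 / b 0) *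
      theta q (a 1 / b 2) * theta q (a 1 / b 3) := by
    rw [Fin.prod_univ_four]
    ring
  have r2 : ∏ j, theta q (a 2 / b j) = theta q (a 2 / b 2) * theta q (a 2 / b 1) *
      theta q (a 2 / b 0) * theta q (a 2 / b 3) := by
    rw [Fin.prod_univ_four]
    ring
  rw [← r0] at c0
  rw [← r1] at c1
  rw [← r2] at c2
  have hK : q * b 3 * a 3 * theta q (a 3 / b 3 / q) *
      (theta q (a 3 / b 0) * theta q (a 3 / b 1) * theta q (a 3 / b 2)) /
      (theta q (a 3 / a 0) * theta q (a 3 / a 1) * theta q (a 3 / a 2)) ≠ 0 := by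
    have := hb 3
    have := ha 3
    positivity
  refine (mul_eq_zero.1 ?_).resolve_left hK
  rw [c0, c1, c2] at s1 s2
  linear_combination jacksonZero q (qPochQuot q a b) (q / a 3) * s2 - s1

end QH3

theorem corollary3p3
    (q : ℂ) (hq0 : 0 < ‖q‖) (hq1 : ‖q‖ < 1)
    (h l t : Fin 3 → ℂ) (ν α x : ℂ)
    (ht : ∀ i, t i ≠ 0) (hx : x ≠ 0)
    -- the balancing condition
    (hν : q ^ (2 * ν) = q ^ (h 0 + h 1 + h 2 - l 0 - l 1 - l 2 + 1))
    -- the coefficients have non-zero denominators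
    (hC : ∀ k : Fin 3, QH3.coeffDen q ν (QH3.exch k h) (QH3.exch k l) (QH3.exch k t) x ≠ 0)
    -- the integrand has no pole at the points where the Jackson integrals evaluate it
    (hpole : ∀ (i : Fin 4) (n : ℕ),
      QH3.integrandDen q ν l t x (QH3.node q ν h t x i * q ^ n) ≠ 0) :
    -- the series defining the Jackson integrals converge (absolutely)
    (∀ i : Fin 4, Summable fun n : ℕ =>
      QH3.integrand q ν h l t x (QH3.node q ν h t x i * q ^ n) *
        (QH3.node q ν h t x i * q ^ n)) ∧
    QH3.coeff q ν h l t x 0 * QH3.phi q ν α h l t 0 3 x +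
      QH3.coeff q ν h l t x 1 * QH3.phi q ν α h l t 1 3 x +
      QH3.coeff q ν h l t x 2 * QH3.phi q ν α h l t 2 3 x = 0 := by
  have hq : q ≠ 0 := norm_pos_iff.1 hq0
  have ha := QH3.numPar_ne_zero (ν := ν) (h := h) hq ht hx
  have hb := QH3.denPar_ne_zero (ν := ν) (l := l) hq ht hx
  have hsum : ∀ i : Fin 4, Summable fun n : ℕ =>
      QH3.integrand q ν h l t x (QH3.node q ν h t x i * q ^ n) *
        (QH3.node q ν h t x i * q ^ n) := fun i => by
    rw [QH3.integrand_eq]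
    refine QH3.summable_qPochQuot hq1 ?_
    simpa [QH3.integrandDen_eq] using hpole i 0
  refine ⟨hsum, ?_⟩
  -- The first three end points are 1/a_i, where the integrand vanishes; dropping that point
  -- replaces them by q/a_i, the form the fourth already has.
  have hnode : ∀ i : Fin 3, QH3.node q ν h t x i.castSucc * q ^ 1 =
      q / QH3.numPar q ν h t x i.castSucc := fun i => by
    rw [QH3.node_castSucc, pow_one, one_div_mul_eq_div]
  have hphi : ∀ i : Fin 3, QH3.phi q ν α h l t i.castSucc 3 x = x ^ (ν - α) *
      (QH3.jacksonZero q (QH3.qPochQuot q (QH3.numPar q ν h t x) (QH3.denPar q ν l t x))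
          (q / QH3.numPar q ν h t x 3) -
        QH3.jacksonZero q (QH3.qPochQuot q (QH3.numPar q ν h t x) (QH3.denPar q ν l t x))
          (q / QH3.numPar q ν h t x i.castSucc)) := fun i => by
    rw [QH3.phi, QH3.jackson, ← QH3.jacksonZero_mul_pow (k := 1) (hsum i.castSucc), hnode,
      QH3.node_three hq, QH3.integrand_eq]
    intro n hn
    rw [QH3.integrand_eq]
    refine QH3.qPochQuot_eq_zero hq1 i.castSucc 0 ?_
    have := ha i.castSucc
    rw [Nat.lt_one_iff.1 hn, QH3.node_castSucc]
    field_simp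
  have hden : ∀ i : Fin 4, ∏ j, QH3.qPoch q
      (QH3.denPar q ν l t x j * (q / QH3.numPar q ν h t x i)) ≠ 0 := fun i => by
    rw [← QH3.integrandDen_eq]
    induction i using Fin.lastCases with
    -- Because of this shift, the fourth end point uses n = 0 and the others n = 1.
    | last => simpa [QH3.node_three hq] using hpole 3 0
    | cast i => rw [← hnode]; exact hpole _ 1
  have d0 := hC 0
  have d1 := hC 1
  rw [(QH3.coeffNum_eq_and_coeffDen_eq (h := QH3.exch 0 h) (l := QH3.exch 0 l)
    (t := QH3.exch 0 t) hq
    (fun _ => ht _) hx).2] at d0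
  rw [(QH3.coeffNum_eq_and_coeffDen_eq (h := QH3.exch 1 h) (l := QH3.exch 1 l)
    (t := QH3.exch 1 t) hq
    (fun _ => ht _) hx).2] at d1
  simp only [QH3.exch_zero, mul_ne_zero_iff] at d0
  simp only [QH3.exch_one, QH3.numPar, QH3.denPar, Matrix.cons_val, mul_ne_zero_iff] at d1
  obtain ⟨⟨⟨⟨⟨h3, h01⟩, h02⟩, hb0⟩, hb1⟩, hb2⟩ := d0
  -- The condition θ(a_1/a_2) ≠ 0 is absent from the denominator of the first coefficient and is
  -- taken from the second.
  have key := QH3.sum_coeffVal_mul_eq_zero hq1 hq ha hb (QH3.prod_numPar hq hν) hden h01 h02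
    (by simpa only [QH3.numPar, Matrix.cons_val] using d1.1.1.1.2) hb0 hb1 hb2 h3
  have p0 := hphi 0
  have p1 := hphi 1
  have p2 := hphi 2
  simp only [Fin.castSucc_zero, Fin.castSucc_one, Fin.reduceCastSucc] at p0 p1 p2
  rw [p0, p1, p2, QH3.coeff_zero hq ht hx, QH3.coeff_one hq ht hx, QH3.coeff_two hq ht hx]
  linear_combination x ^ (ν - α) * key
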